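/- For finite simple graphs $G$ and $H$, the Ramsey number $r(G,H)$ is the smallest positive integer $N$ such that every red-blue edge-colouring of the complete graph $K_N$ contains a red subgraph isomorphic to $G$ or a blue subgraph isomorphic to $H$. Let $B_k=K_2+\overline{K}_k$ be the book on $k+2$ vertices, i.e. the disjoint union of $K_2$ and $k$ isolated vertices together with all edges between them, and let $tB_k$ be the union of $t$ vertex-disjoint copies of $B_k$. **Theorem.** Let $k,t$ be positive integers and let $n\ge 111t^3k^3$ be an integer. If $G$ is a connected finite simple graph with $n$ vertices and at most $n\left(1+\dfrac{1}{127t^2k^2+79t^2k}\right)$ edges, then $$r(G,tB_k)=2n+t-2.$$ -/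

import Mathlib

open scoped SimpleGraph

namespace BookRamsey

/-- The join `G + H`: the disjoint union of `G` and `H` together with all edges between them. -/
def join {V W : Type*} (G : SimpleGraph V) (H : SimpleGraph W) : SimpleGraph (V ⊕ W) :=
  (G ⊕g H) ⊔ completeBipartiteGraph V W

/-- The book `B_k = K_2 + (complement of K_k)`, on `k + 2` vertices. -/
def book (k : ℕ) : SimpleGraph (Fin 2 ⊕ Fin k) :=
  join (⊤ : SimpleGraph (Fin 2)) (⊥ : SimpleGraph (Fin k))

/-- `t H`: the union of `t` vertex-disjoint copies of `H`. -/
def copies (t : ℕ) {W : Type*} (H : SimpleGraph W) : SimpleGraph (Fin t × W) where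
  Adj p q := p.1 = q.1 ∧ H.Adj p.2 q.2
  symm := ⟨fun _ _ h => ⟨h.1.symm, h.2.symm⟩⟩
  loopless := ⟨fun p h => H.loopless.irrefl p.2 h.2⟩

/-- Every red-blue edge colouring of `K_N` has a red copy of `G` or a blue copy of `H`.
A colouring is given by the graph `R` of its red edges, the blue edges being those of `Rᶜ`;
`⊑` is containment as a (not necessarily induced) subgraph. -/
def Arrows (N : ℕ) {V W : Type*} (G : SimpleGraph V) (H : SimpleGraph W) : Prop :=
  ∀ R : SimpleGraph (Fin N), G ⊑ R ∨ H ⊑ Rᶜ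

/-- `r(G, H) = N`: the number `N` is the smallest positive integer such that every red-blue edge
colouring of `K_N` has a red copy of `G` or a blue copy of `H`. -/
def IsRamseyNumber {V W : Type*} (G : SimpleGraph V) (H : SimpleGraph W) (N : ℕ) : Prop :=
  IsLeast {M : ℕ | 0 < M ∧ Arrows M G H} N

end BookRamsey

/-! Lower bound: take red cliques on `n - 1`, `n - 1` and at most `t - 1` vertices, with all other
edges blue. A connected red `G` would lie in one clique. Every blue book contains a triangle, so it
uses a vertex of the third clique, which is too small for `t` disjoint books (`not_arrows`).

Upper bound: let `N = 2n + t - 2`, let `G` have at most `n + l` edges, and suppose there is neither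
a red `G` nor a blue `tB_k`. Three facts drive the argument. (1) Any `n + t - 1` vertices contain
`t` disjoint blue edges. Otherwise, after discarding fewer than `t` vertices, all blue edges meet a
few vertices of small blue degree, and `G` fits in red (`exists_embOn_of_no_matching`). (2) Deleting
a small set `Z`, the union of a maximal family of disjoint blue books, leaves no blue book
(`exists_bookFreeOn`). Inside a blue neighbourhood the blue degrees are then below `k`, so sparse
graphs embed there greedily. (3) Hence every connected graph with excess at most `l` and at most `n
- tk` vertices embeds in red outside `Z` (`ConnOn.exists_embOn_of_bookFree`).

It remains to gain the last `tk` vertices. A connected sparse graph has either many leaves or a long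
suspended path (`ConnOn.exists_suspOn`). With a long path, contract `tk` of its inner vertices,
embed, and reinsert them one at a time. A failed insertion makes each outside vertex blue to most of
the path, and `t` disjoint blue edges outside then become spines of `t` books
(`SuspOn.exists_embOn_of_shortcut`). With many leaves, embed `G` without them. If Hall's condition
for putting them back fails, the parents of some leaves are blue to a huge set
(`exists_deficient_leaves`). Many such parents serve as common pages for `t` disjoint blue edges. If
few parents are involved and leaves are spread out, the huge set is nearly all red and holds `G`. If
one vertex carries many leaves, its large blue degree propagates until the blue graph is nearly
complete bipartite; then one side, enlarged by exceptional vertices, holds `G`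
(`isContained_of_bipartition`). -/

namespace BookRamsey
open Finset Classical

/-! ### Sparse connected graphs and how deletion or contraction affects them. -/

section Sparse

variable {V : Type*}

/-- The neighbours of `v` in `S`. -/
noncomputable def nbrOn (H : SimpleGraph V) (S : Finset V) (v : V) : Finset V :=
  {u ∈ S | H.Adj v u}

/-- The number of neighbours of `v` in `S`. -/
noncomputable def degOn (H : SimpleGraph V) (S : Finset V) (v : V) : ℕ := #(nbrOn H S v)

/-- The sum of the degrees of the subgraph induced on `S`. -/
noncomputable def degSum (H : SimpleGraph V) (S : Finset V) : ℕ := ∑ v ∈ S, degOn H S v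

/-- The subgraph induced on `S` is connected, expressed through cuts. -/
def ConnOn (H : SimpleGraph V) (S : Finset V) : Prop :=
  ∀ T ⊆ S, T.Nonempty → T ≠ S → ∃ u ∈ T, ∃ v ∈ S, v ∉ T ∧ H.Adj u v

/-- Every nonempty `T ⊆ S` spans at most `#T + l` edges. -/
def Sparse (H : SimpleGraph V) (S : Finset V) (l : ℕ) : Prop :=
  ∀ T ⊆ S, T.Nonempty → degSum H T ≤ 2 * (#T + l)

@[simp] theorem mem_nbrOn {H : SimpleGraph V} {S : Finset V} {v u : V} :
    u ∈ nbrOn H S v ↔ u ∈ S ∧ H.Adj v u := by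
  simp [nbrOn]

theorem nbrOn_subset (H : SimpleGraph V) (S : Finset V) (v : V) : nbrOn H S v ⊆ S :=
  filter_subset _ _

theorem degOn_mono (H : SimpleGraph V) {S T : Finset V} (h : S ⊆ T) (v : V) :
    degOn H S v ≤ degOn H T v :=
  card_le_card (filter_subset_filter _ h)

theorem degOn_eq_sum (H : SimpleGraph V) (S : Finset V) (v : V) :
    degOn H S v = ∑ u ∈ S, if H.Adj v u then 1 else 0 := by
  rw [degOn, nbrOn, card_filter]

theorem degOn_insert_self (H : SimpleGraph V) (S : Finset V) (v : V) :
    degOn H (insert v S) v = degOn H S v := by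
  unfold degOn nbrOn
  rw [filter_insert, if_neg (H.loopless.irrefl v)]

theorem degSum_insert (H : SimpleGraph V) {S : Finset V} {v : V} (hv : v ∉ S) :
    degSum H (insert v S) = degSum H S + 2 * degOn H S v := by
  unfold degSum
  rw [sum_insert hv, degOn_insert_self]
  have h : ∀ u ∈ S, degOn H (insert v S) u = degOn H S u + if H.Adj v u then 1 else 0 := by
    intro u _
    rw [degOn_eq_sum, degOn_eq_sum, sum_insert hv, add_comm]
    simp only [H.adj_comm u v]
  rw [sum_congr rfl h, sum_add_distrib, ← degOn_eq_sum]
  ring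

theorem degSum_erase (H : SimpleGraph V) {S : Finset V} {v : V} (hv : v ∈ S) :
    degSum H S = degSum H (S.erase v) + 2 * degOn H S v := by
  have h := degSum_insert H (notMem_erase v S)
  have h2 := degOn_insert_self H (S.erase v) v
  rw [insert_erase hv] at h h2
  rw [h, h2]

/-- Grow `T` to `S` one vertex at a time along cut edges. Each new vertex brings at least one edge,
so the excess of edges over vertices is never larger on a subset. -/
theorem degSum_add_le (H : SimpleGraph V) {S : Finset V} (hS : ConnOn H S) :
    ∀ m : ℕ, ∀ T ⊆ S, T.Nonempty → #S = #T + m → degSum H T + 2 * m ≤ degSum H S := by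
  intro m
  induction m with
  | zero =>
    intro T hT _ hc
    rw [eq_of_subset_of_card_le hT (by omega)]; simp
  | succ m ih =>
    intro T hT hne hc
    obtain ⟨u, hu, v, hv, hvT, huv⟩ := hS T hT hne (by rintro rfl; omega)
    have h1 := ih (insert v T) (insert_subset hv hT) (insert_nonempty _ _)
      (by rw [card_insert_of_notMem hvT]; omega)
    rw [degSum_insert H hvT] at h1
    have h2 : 1 ≤ degOn H T v := card_pos.2 ⟨u, by simp [hu, huv.symm]⟩
    omega

theorem ConnOn.sparse {H : SimpleGraph V} {S : Finset V} (hS : ConnOn H S) {l : ℕ}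
    (h : degSum H S ≤ 2 * (#S + l)) : Sparse H S l := by
  intro T hT hne
  have h1 := card_le_card hT
  have := degSum_add_le H hS (#S - #T) T hT hne (by omega)
  omega

theorem ConnOn.one_le_degOn {H : SimpleGraph V} {S : Finset V} (hS : ConnOn H S) (h2 : 2 ≤ #S)
    {v : V} (hv : v ∈ S) : 1 ≤ degOn H S v := by
  obtain ⟨u, hu, w, hw, hwT, huw⟩ := hS {v} (by simpa using hv) (by simp)
    (by rintro h; rw [← h] at h2; simp at h2)
  rw [mem_singleton] at hu; subst hu
  exact card_pos.2 ⟨w, by simp [hw, huw]⟩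

theorem ConnOn.erase {H : SimpleGraph V} {S : Finset V} (hS : ConnOn H S)
    {v : V} (hv : v ∈ S) (hd : degOn H S v ≤ 1) : ConnOn H (S.erase v) := by
  intro T hT hne hTS
  have hvT : v ∉ T := fun h => by simpa using hT h
  have hTS' : T ⊆ S := hT.trans (erase_subset _ _)
  have uniq : ∀ a ∈ S, ∀ b ∈ S, H.Adj v a → H.Adj v b → a = b := fun a ha b hb h1 h2 =>
    card_le_one.1 hd a (by simp [ha, h1]) b (by simp [hb, h2])
  by_cases hw : ∃ w ∈ T, H.Adj v w
  · obtain ⟨w, hwT, hw⟩ := hw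
    obtain ⟨a, ha, b, hb, hbT, hab⟩ := hS (insert v T) (insert_subset hv hTS') (insert_nonempty _ _)
      (by rintro rfl; exact hTS (by simp [hvT]))
    simp only [mem_insert, not_or] at ha hbT
    rcases ha with rfl | ha
    · exact absurd (uniq b hb w (hTS' hwT) hab hw ▸ hwT) hbT.2
    · exact ⟨a, ha, b, mem_erase.2 ⟨hbT.1, hb⟩, hbT.2, hab⟩
  · push Not at hw
    obtain ⟨a, ha, b, hb, hbT, hab⟩ := hS T hTS' hne (by rintro rfl; exact hvT hv)
    refine ⟨a, ha, b, mem_erase.2 ⟨?_, hb⟩, hbT, hab⟩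
    rintro rfl
    exact hw a ha hab.symm

theorem ConnOn.sdiff {H : SimpleGraph V} {S : Finset V} (hS : ConnOn H S) (L : Finset V) :
    L ⊆ S → (∀ v ∈ L, degOn H S v ≤ 1) → ConnOn H (S \ L) := by
  induction L using Finset.induction_on with
  | empty => intro _ _; simpa using hS
  | insert v L hv ih =>
    intro hL hd
    have hvS : v ∈ S \ L := mem_sdiff.2 ⟨hL (mem_insert_self _ _), hv⟩
    have h := (ih ((subset_insert _ _).trans hL) fun u hu => hd u (mem_insert_of_mem hu)).erase hvS
      ((degOn_mono H sdiff_subset v).trans (hd v (mem_insert_self _ _)))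
    rwa [show S \ insert v L = (S \ L).erase v by ext; simp; tauto]

/-- If a cut separates `u` from `w`, the new edge crosses it. Otherwise `v` can be put on their
common side, and an old edge avoiding `v` crosses. -/
theorem ConnOn.contract {H : SimpleGraph V} {S : Finset V} (hS : ConnOn H S) {u v w : V}
    (hu : u ∈ S) (hv : v ∈ S) (hw : w ∈ S) (huw : u ≠ w) (huv : u ≠ v) (hwv : w ≠ v)
    (h : ∀ x ∈ S, H.Adj v x → x = u ∨ x = w) :
    ConnOn (H ⊔ SimpleGraph.edge u w) (S.erase v) := by
  intro T hT hne hTS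
  have hvT : v ∉ T := fun h => by simpa using hT h
  have hTS' : T ⊆ S := hT.trans (erase_subset _ _)
  have e1 : (H ⊔ SimpleGraph.edge u w).Adj u w := by simp [SimpleGraph.edge_adj, huw]
  by_cases hu' : u ∈ T <;> by_cases hw' : w ∈ T
  · obtain ⟨a, ha, b, hb, hbT, hab⟩ := hS (insert v T) (insert_subset hv hTS') (insert_nonempty _ _)
      (by rintro rfl; exact hTS (by simp [hvT]))
    simp only [mem_insert, not_or] at ha hbT
    rcases ha with rfl | ha
    · rcases h b hb hab with rfl | rfl
      · exact absurd hu' hbT.2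
      · exact absurd hw' hbT.2
    · exact ⟨a, ha, b, mem_erase.2 ⟨hbT.1, hb⟩, hbT.2, Or.inl hab⟩
  · exact ⟨u, hu', w, mem_erase.2 ⟨hwv, hw⟩, hw', e1⟩
  · exact ⟨w, hw', u, mem_erase.2 ⟨huv, hu⟩, hu', e1.symm⟩
  · obtain ⟨a, ha, b, hb, hbT, hab⟩ := hS T hTS' hne (by rintro rfl; exact hvT hv)
    refine ⟨a, ha, b, mem_erase.2 ⟨?_, hb⟩, hbT, Or.inl hab⟩
    rintro rfl
    rcases h a (hTS' ha) hab.symm with rfl | rfl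
    · exact hu' ha
    · exact hw' ha

theorem degSum_sup_edge_le (H : SimpleGraph V) (T : Finset V) {u w : V} (huw : u ≠ w) :
    degSum (H ⊔ SimpleGraph.edge u w) T ≤ degSum H T + 2 := by
  have hadj : ∀ x y, (H ⊔ SimpleGraph.edge u w).Adj x y →
      H.Adj x y ∨ (x = u ∧ y = w) ∨ (x = w ∧ y = u) := by
    intro x y hxy
    simp only [SimpleGraph.sup_adj, SimpleGraph.edge_adj] at hxy
    tauto
  generalize H ⊔ SimpleGraph.edge u w = H' at hadj ⊢
  have h : ∀ v ∈ T, degOn H' T v ≤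
      degOn H T v + ((if v = u then 1 else 0) + if v = w then 1 else 0) := by
    intro v _
    have hs : nbrOn H' T v ⊆ nbrOn H T v ∪
        ((if v = u then {w} else ∅) ∪ if v = w then {u} else ∅) := by
      intro x hx
      rw [mem_nbrOn] at hx
      simp only [mem_union, mem_nbrOn]
      rcases hadj _ _ hx.2 with h | ⟨rfl, rfl⟩ | ⟨rfl, rfl⟩ <;> simp_all
    refine (card_le_card hs).trans ((card_union_le _ _).trans ?_)
    refine Nat.add_le_add le_rfl ((card_union_le _ _).trans ?_)
    split_ifs <;> simp
  refine (sum_le_sum h).trans ?_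
  rw [sum_add_distrib, sum_add_distrib]
  have a1 : ∀ a : V, (∑ v ∈ T, if v = a then 1 else 0) ≤ 1 := by
    intro a; rw [sum_ite_eq']; split_ifs <;> simp
  have := a1 u
  have := a1 w
  unfold degSum
  omega

theorem connOn_univ [Fintype V] {G : SimpleGraph V} (hG : G.Connected) : ConnOn G univ := by
  intro T _ hne hT
  obtain ⟨a, ha⟩ := hne
  obtain ⟨b, hb⟩ : ∃ b, b ∉ T := by
    by_contra! h; exact hT (eq_univ_of_forall h)
  obtain ⟨p⟩ := hG.preconnected a b
  obtain ⟨d, hd, h1, h2⟩ := p.exists_boundary_dart (T : Set V) (by simpa using ha) (by simpa using hb)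
  exact ⟨d.fst, by simpa using h1, d.snd, mem_univ _, by simpa using h2, d.adj⟩

theorem degSum_univ [Fintype V] (G : SimpleGraph V) : degSum G univ = 2 * G.edgeSet.ncard := by
  rw [← SimpleGraph.coe_edgeFinset, Set.ncard_coe_finset, ← G.sum_degrees_eq_twice_card_edges]
  refine sum_congr rfl fun v _ => ?_
  rw [degOn, ← SimpleGraph.card_neighborFinset_eq_degree]
  congr 1; ext; simp

end Sparse

/-! ### Greedy red embeddings of sparse graphs. -/

section Embedding

variable {V W : Type*}

/-- `f` embeds the subgraph of `H` induced on `S` into the subgraph of `R` induced on `U`. -/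
structure EmbOn (H : SimpleGraph V) (R : SimpleGraph W) (S : Finset V) (U : Finset W)
    (f : V → W) : Prop where
  inj : ∀ u ∈ S, ∀ v ∈ S, f u = f v → u = v
  mem : ∀ v ∈ S, f v ∈ U
  adj : ∀ u ∈ S, ∀ v ∈ S, H.Adj u v → R.Adj (f u) (f v)

theorem EmbOn.injOn {H : SimpleGraph V} {R : SimpleGraph W} {S : Finset V} {U : Finset W}
    {f : V → W} (hf : EmbOn H R S U f) : Set.InjOn f S :=
  fun u hu v hv h => hf.inj u hu v hv h

theorem EmbOn.card_image {H : SimpleGraph V} {R : SimpleGraph W} {S : Finset V} {U : Finset W}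
    {f : V → W} (hf : EmbOn H R S U f) : #(S.image f) = #S :=
  card_image_of_injOn hf.injOn

theorem EmbOn.mono {H : SimpleGraph V} {R : SimpleGraph W} {S T : Finset V} {U U' : Finset W}
    {f : V → W} (hf : EmbOn H R S U f) (hT : T ⊆ S) (hU : U ⊆ U') : EmbOn H R T U' f :=
  ⟨fun u hu v hv => hf.inj u (hT hu) v (hT hv), fun v hv => hU (hf.mem v (hT hv)),
    fun u hu v hv => hf.adj u (hT hu) v (hT hv)⟩

theorem EmbOn.isContained [Fintype V] {H : SimpleGraph V} {R : SimpleGraph W} {U : Finset W}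
    {f : V → W} (hf : EmbOn H R univ U f) : H ⊑ R :=
  ⟨⟨⟨f, fun {u v} h => hf.adj u (mem_univ _) v (mem_univ _) h⟩,
    fun u v h => hf.inj u (mem_univ _) v (mem_univ _) h⟩⟩

theorem EmbOn.insert {H : SimpleGraph V} {R : SimpleGraph W} {S : Finset V} {U : Finset W}
    {f : V → W} (hf : EmbOn H R S U f) {v : V} (hv : v ∉ S) {w : W} (hwU : w ∈ U)
    (hw : ∀ u ∈ S, f u ≠ w) (h : ∀ u ∈ S, H.Adj v u → R.Adj w (f u)) :
    EmbOn H R (insert v S) U (Function.update f v w) := by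
  have e : ∀ u ∈ S, Function.update f v w u = f u := fun u hu =>
    Function.update_of_ne (by rintro rfl; exact hv hu) _ _
  have e' : Function.update f v w v = w := Function.update_self _ _ _
  refine ⟨?_, ?_, ?_⟩
  · intro a ha b hb hab
    rcases mem_insert.1 ha with rfl | ha' <;> rcases mem_insert.1 hb with rfl | hb'
    · rfl
    · rw [e', e b hb'] at hab; exact absurd hab.symm (hw b hb')
    · rw [e', e a ha'] at hab; exact absurd hab (hw a ha')
    · rw [e a ha', e b hb'] at hab; exact hf.inj a ha' b hb' hab
  · intro a ha
    rcases mem_insert.1 ha with rfl | ha'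
    · rwa [e']
    · rw [e a ha']; exact hf.mem a ha'
  · intro a ha b hb hab
    rcases mem_insert.1 ha with rfl | ha' <;> rcases mem_insert.1 hb with rfl | hb'
    · exact absurd hab (H.loopless.irrefl _)
    · rw [e', e b hb']; exact h b hb' hab
    · rw [e', e a ha']; exact (h a ha' hab.symm).symm
    · rw [e a ha', e b hb']; exact hf.adj a ha' b hb' hab

theorem exists_min_degOn (H : SimpleGraph V) {T S : Finset V} (hT : T ⊆ S) (hne : T.Nonempty) :
    ∃ v ∈ T, (∀ u ∈ T, degOn H S v ≤ degOn H S u) ∧ degOn H S v * #T ≤ degSum H S := by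
  obtain ⟨v, hv, hmin⟩ := exists_min_image T (degOn H S) hne
  refine ⟨v, hv, hmin, ?_⟩
  have h1 := card_nsmul_le_sum T (degOn H S) _ hmin
  have h2 : ∑ u ∈ T, degOn H S u ≤ degSum H S := sum_le_sum_of_subset hT
  rw [smul_eq_mul] at h1
  linarith [mul_comm (#T) (degOn H S v)]

theorem degOn_lt_card (H : SimpleGraph V) {S : Finset V} {v : V} (hv : v ∈ S) :
    degOn H S v + 1 ≤ #S := by
  exact card_lt_card (filter_ssubset.2 ⟨v, hv, H.loopless.irrefl v⟩)

/-- Peel off a low-degree vertex other than the root, embed the rest, then place it. Forbidden are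
the used vertices and at most `d` blue neighbours for each embedded neighbour. The root is never
peeled off, so its image can be prescribed. -/
theorem exists_embOn_rooted_aux {R : SimpleGraph W} {A : Finset W} {d : ℕ}
    (hA : ∀ a ∈ A, degOn Rᶜ A a ≤ d) (H : SimpleGraph V) {p : V} {a : W} (ha : a ∈ A)
    (S : Finset V) : p ∈ S →
    (∀ T ⊆ S, p ∈ T → T ≠ {p} → ∃ v ∈ T, v ≠ p ∧ #T + d * degOn H T v ≤ #A) →
    ∃ f, EmbOn H R S A f ∧ f p = a := by
  induction S using Finset.strongInduction with
  | H S ih =>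
  intro hp hS
  by_cases hSp : S = {p}
  · subst hSp
    refine ⟨fun _ => a, ⟨?_, fun _ _ => ha, ?_⟩, rfl⟩
    · simp
    · simp
  obtain ⟨v, hv, hvp, hc⟩ := hS S Subset.rfl hp hSp
  obtain ⟨f, hf, hfp⟩ := ih (S.erase v) (erase_ssubset hv) (mem_erase.2 ⟨hvp.symm, hp⟩)
    fun T hT => hS T (hT.trans (erase_subset _ _))
  set N := nbrOn H (S.erase v) v with hN
  have hNc : #N ≤ degOn H S v := degOn_mono H (erase_subset v S) v
  obtain ⟨w, hwA, hw⟩ : ∃ w ∈ A, w ∉ (S.erase v).image f ∪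
      N.biUnion fun u => nbrOn Rᶜ A (f u) := by
    by_contra! hcon
    have h1 := card_le_card (show A ⊆ _ from hcon)
    have h2 := h1.trans (card_union_le _ _)
    have h3 : #(N.biUnion fun u => nbrOn Rᶜ A (f u)) ≤ #N * d :=
      card_biUnion_le_card_mul _ _ _ fun u hu => hA _ (hf.mem u (nbrOn_subset _ _ _ hu))
    have h4 : #((S.erase v).image f) ≤ #(S.erase v) := card_image_le
    rw [card_erase_of_mem hv] at h4
    have : 0 < #S := card_pos.2 ⟨v, hv⟩
    have h5 : #N * d ≤ d * degOn H S v := by rw [mul_comm]; exact Nat.mul_le_mul_left _ hNc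
    omega
  rw [mem_union, not_or] at hw
  have hfw : ∀ u ∈ S.erase v, f u ≠ w := fun u hu h => hw.1 (mem_image.2 ⟨u, hu, h⟩)
  have := hf.insert (notMem_erase v S) hwA hfw (by
    intro u hu hvu
    by_contra hR
    refine hw.2 (mem_biUnion.2 ⟨u, mem_nbrOn.2 ⟨hu, hvu⟩, mem_nbrOn.2 ⟨hwA, ?_⟩⟩)
    rw [SimpleGraph.compl_adj]
    exact ⟨hfw u hu, fun h => hR h.symm⟩)
  rw [insert_erase hv] at this
  exact ⟨_, this, by rw [Function.update_of_ne hvp.symm, hfp]⟩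

/-- Average the degrees over `T` without `p`. If the minimum `δ` is at least 3, then `3(#T - 1) ≤
2(#T + l)` forces `#T ≤ 2l + 3`, whence `δ ≤ #T - 1` and `δ² ≤ δ(#T - 1) ≤ 2(#T + l) ≤ 6l + 6`. -/
theorem Sparse.exists_low_degree {H : SimpleGraph V} {S : Finset V} {l : ℕ} (hS : Sparse H S l)
    {T : Finset V} (hT : T ⊆ S) {p : V} (hp : p ∈ T) (hTp : T ≠ {p}) :
    ∃ v ∈ T, v ≠ p ∧ (degOn H T v ≤ 2 ∨ #T ≤ 2 * l + 3 ∧ degOn H T v ≤ 2 * l + 2 ∧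
      degOn H T v * degOn H T v ≤ 6 * l + 6) := by
  have hne : (T.erase p).Nonempty := by
    rw [nonempty_iff_ne_empty]
    intro h
    rw [erase_eq_empty_iff] at h
    rcases h with rfl | h
    · simp at hp
    · exact hTp h
  obtain ⟨v, hv, hmin, hsum⟩ := exists_min_degOn H (erase_subset p T) hne
  have hvT := mem_of_mem_erase hv
  refine ⟨v, hvT, ne_of_mem_erase hv, ?_⟩
  by_cases h2 : degOn H T v ≤ 2
  · exact Or.inl h2
  right
  have h3 := hS T hT ⟨p, hp⟩
  have h4 := degOn_lt_card H hvT
  rw [card_erase_of_mem hp] at hsum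
  have h5 : 3 * (#T - 1) ≤ degOn H T v * (#T - 1) := Nat.mul_le_mul_right _ (by omega)
  have h6 : degOn H T v * degOn H T v ≤ degOn H T v * (#T - 1) := Nat.mul_le_mul_left _ (by omega)
  omega

/-- If the blue degrees inside `A` are at most `d`, a sparse graph embeds in red into `A`, with
one vertex sent to a prescribed place. -/
theorem Sparse.exists_embOn_rooted {H : SimpleGraph V} {S : Finset V} {l : ℕ} (hS : Sparse H S l)
    {R : SimpleGraph W} {A : Finset W} {d : ℕ} (hA : ∀ a ∈ A, degOn Rᶜ A a ≤ d)
    (h1 : #S + 2 * d ≤ #A) (h2 : 2 * l + 3 + d * (2 * l + 2) ≤ #A)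
    {p : V} (hp : p ∈ S) {a : W} (ha : a ∈ A) : ∃ f, EmbOn H R S A f ∧ f p = a := by
  refine exists_embOn_rooted_aux hA H ha S hp fun T hT hpT hTp => ?_
  obtain ⟨v, hv, hvp, h | ⟨h3, h4, -⟩⟩ := hS.exists_low_degree hT hpT hTp
  · refine ⟨v, hv, hvp, ?_⟩
    have := card_le_card hT
    have := Nat.mul_le_mul_left d h
    omega
  · refine ⟨v, hv, hvp, ?_⟩
    have := Nat.mul_le_mul_left d h4
    omega

theorem Sparse.exists_embOn {H : SimpleGraph V} {S : Finset V} {l : ℕ} (hS : Sparse H S l)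
    {R : SimpleGraph W} {A : Finset W} {d : ℕ} (hA : ∀ a ∈ A, degOn Rᶜ A a ≤ d)
    (h1 : #S + 2 * d ≤ #A) (h2 : 2 * l + 3 + d * (2 * l + 2) ≤ #A)
    (hne : S.Nonempty) : ∃ f, EmbOn H R S A f := by
  obtain ⟨p, hp⟩ := hne
  have : 0 < #A := by omega
  obtain ⟨a, ha⟩ := card_pos.1 this
  obtain ⟨f, hf, -⟩ := hS.exists_embOn_rooted hA h1 h2 hp ha
  exact ⟨f, hf⟩

theorem Sparse.exists_embOn_of_sqrt {H : SimpleGraph V} {S : Finset V} {l : ℕ} (hS : Sparse H S l)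
    {R : SimpleGraph W} {A : Finset W} {d : ℕ} (hA : ∀ a ∈ A, degOn Rᶜ A a ≤ d)
    (h1 : #S + d * Nat.sqrt (6 * l + 6) ≤ #A)
    (hne : S.Nonempty) : ∃ f, EmbOn H R S A f := by
  obtain ⟨p, hp⟩ := hne
  have : 0 < #S := card_pos.2 ⟨p, hp⟩
  obtain ⟨a, ha⟩ := card_pos.1 (show 0 < #A by omega)
  suffices h : ∃ f, EmbOn H R S A f ∧ f p = a from ⟨h.choose, h.choose_spec.1⟩
  refine exists_embOn_rooted_aux hA H ha S hp fun T hT hpT hTp => ?_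
  have hr : 2 ≤ Nat.sqrt (6 * l + 6) := Nat.le_sqrt.2 (by omega)
  obtain ⟨v, hv, hvp, h⟩ := hS.exists_low_degree hT hpT hTp
  refine ⟨v, hv, hvp, ?_⟩
  have h3 : degOn H T v ≤ Nat.sqrt (6 * l + 6) := by
    rcases h with h | h
    · omega
    · exact Nat.le_sqrt.2 h.2.2
  have := Nat.mul_le_mul_left d h3
  have := card_le_card hT
  omega

/-- There is no blue book with `k` pages inside `U`. -/
def BookFreeOn (R : SimpleGraph W) (U : Finset W) (k : ℕ) : Prop :=
  ∀ x ∈ U, ∀ y ∈ U, Rᶜ.Adj x y → #(nbrOn Rᶜ U x ∩ nbrOn Rᶜ U y) < k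

/-- Blue neighbours of `a` inside a blue neighbourhood of `x` are pages of a book with spine `xa`.
-/
theorem BookFreeOn.degOn_le {R : SimpleGraph W} {U : Finset W} {k : ℕ} (h : BookFreeOn R U k)
    {x : W} (hx : x ∈ U) {A : Finset W} (hA : A ⊆ U) (hxA : ∀ a ∈ A, Rᶜ.Adj x a) :
    ∀ a ∈ A, degOn Rᶜ A a ≤ k - 1 := by
  intro a ha
  have h1 := h x hx a (hA ha) (hxA a ha)
  have h2 : degOn Rᶜ A a ≤ #(nbrOn Rᶜ U x ∩ nbrOn Rᶜ U a) := by
    refine card_le_card fun z hz => ?_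
    rw [mem_nbrOn] at hz
    simp only [mem_inter, mem_nbrOn]
    exact ⟨⟨hA hz.1, hxA z hz.1⟩, hA hz.1, hz.2⟩
  omega

/-- A sparse graph on at most about a third of the vertices embeds in red
if there is no blue book. -/
theorem Sparse.exists_embOn_of_bookFree [Fintype W] [Nonempty W] {R : SimpleGraph W} {k l : ℕ}
    (hR : BookFreeOn R univ k) {H : SimpleGraph V} (S : Finset V) :
    Sparse H S l → 3 * #S + (k - 1) * (6 * l + 6) ≤ Fintype.card W →
    8 * l + (k - 1) * (6 * l + 6) ≤ Fintype.card W → ∃ f, EmbOn H R S univ f := by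
  induction S using Finset.strongInduction with
  | H S ih =>
  intro hS h1 h2
  rcases S.eq_empty_or_nonempty with rfl | hne
  · exact ⟨fun _ => Classical.arbitrary W, by simp, by simp, by simp⟩
  obtain ⟨v, hv, -, hsum⟩ := exists_min_degOn H (Subset.refl S) hne
  have hlt : #(S.erase v) + 1 = #S := card_erase_add_one hv
  obtain ⟨f, hf⟩ := ih (S.erase v) (erase_ssubset hv)
    (fun T hT => hS T (hT.trans (erase_subset _ _))) (by omega) h2
  by_contra! hcon
  set N := nbrOn H (S.erase v) v with hN
  have hNc : #N ≤ degOn H S v := degOn_mono H (erase_subset v S) v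
  -- The embedding of `S` minus `v` does not extend, so every vertex is used or is blue to the image
  -- of a neighbour of `v`.
  have hcover : (univ : Finset W) ⊆ (S.erase v).image f ∪
      N.biUnion fun u => nbrOn Rᶜ univ (f u) := by
    intro w _
    by_contra hw
    rw [mem_union, not_or] at hw
    have hfw : ∀ u ∈ S.erase v, f u ≠ w := fun u hu h => hw.1 (mem_image.2 ⟨u, hu, h⟩)
    have := hf.insert (notMem_erase v S) (mem_univ w) hfw (by
      intro u hu hvu
      by_contra hR
      refine hw.2 (mem_biUnion.2 ⟨u, mem_nbrOn.2 ⟨hu, hvu⟩, mem_nbrOn.2 ⟨mem_univ _, ?_⟩⟩)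
      rw [SimpleGraph.compl_adj]
      exact ⟨hfw u hu, fun h => hR h.symm⟩)
    rw [insert_erase hv] at this
    exact hcon _ this
  set r := Nat.sqrt (6 * l + 6) with hr
  -- A larger blue neighbourhood would have blue degrees at most `k - 1` and would itself receive
  -- `S` greedily.
  have hdeg : ∀ x : W, #(nbrOn Rᶜ univ x) + 1 ≤ #S + (k - 1) * r := by
    intro x
    by_contra hx
    have hA := hR.degOn_le (mem_univ x) (A := nbrOn Rᶜ univ x) (subset_univ _) (by simp)
    obtain ⟨g, hg⟩ := hS.exists_embOn_of_sqrt hA (by rw [← hr]; omega) hne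
    exact hcon g (hg.mono Subset.rfl (subset_univ _))
  have h3 := (card_le_card hcover).trans (card_union_le _ _)
  have h4 : #(N.biUnion fun u => nbrOn Rᶜ univ (f u)) ≤ #N * (#S + (k - 1) * r - 1) :=
    card_biUnion_le_card_mul _ _ _ fun u hu => by have := hdeg (f u); omega
  have h5 : #((S.erase v).image f) ≤ #(S.erase v) := card_image_le
  have h6 : #N * (#S + (k - 1) * r - 1) ≤ degOn H S v * (#S + (k - 1) * r) :=
    Nat.mul_le_mul hNc (by omega)
  rw [card_univ] at h3
  have h7 : Fintype.card W + 1 ≤ #S + degOn H S v * (#S + (k - 1) * r) := by omega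
  have hr2 : r * r ≤ 6 * l + 6 := Nat.sqrt_le _
  have hr3 : 2 ≤ r := Nat.le_sqrt.2 (by omega)
  have h8 := hS S Subset.rfl hne
  have h9 := degOn_lt_card H hv
  generalize degOn H S v = δ at *
  -- For `δ ≤ 2` the cover has about `3 * #S` vertices. For `δ ≥ 3` sparsity gives `#S ≤ 2l` and `δ
  -- * #S ≤ 2(#S + l)`, so `#S + δ * #S ≤ 8l`.
  by_cases hd : δ ≤ 2
  · have a1 : δ * (#S + (k - 1) * r) ≤ 2 * (#S + (k - 1) * r) := Nat.mul_le_mul_right _ hd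
    have a2 : 2 * r ≤ 6 * l + 6 := (Nat.mul_le_mul_right r hr3).trans hr2
    have a3 := Nat.mul_le_mul_left (k - 1) a2
    have a4 : 2 * ((k - 1) * r) = (k - 1) * (2 * r) := by ring
    omega
  · have a1 : 3 * #S ≤ δ * #S := Nat.mul_le_mul_right _ (by omega)
    have a2 : δ * δ ≤ δ * #S := Nat.mul_le_mul_left _ (by omega)
    have a3 : δ ≤ r := Nat.le_sqrt.2 (by omega)
    have a4 : δ * ((k - 1) * r) ≤ (k - 1) * (6 * l + 6) := by
      calc δ * ((k - 1) * r) ≤ r * ((k - 1) * r) := Nat.mul_le_mul_right _ a3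
        _ = (k - 1) * (r * r) := by ring
        _ ≤ _ := Nat.mul_le_mul_left _ hr2
    rw [mul_add] at h7
    omega

end Embedding

/-! ### Distance layers, suspended paths and their contraction. -/

section Suspended

variable {V W : Type*}

/-- `p 0, …, p (q + 1)` is a path in `S` whose inner vertices have degree two in `S`. -/
structure SuspOn (H : SimpleGraph V) (S : Finset V) (p : ℕ → V) (q : ℕ) : Prop where
  mem : ∀ i ≤ q + 1, p i ∈ S
  inj : ∀ i ≤ q + 1, ∀ j ≤ q + 1, p i = p j → i = j
  adj : ∀ i ≤ q, H.Adj (p i) (p (i + 1))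
  nbr : ∀ i, 1 ≤ i → i ≤ q → ∀ u ∈ S, H.Adj (p i) u → u = p (i - 1) ∨ u = p (i + 1)

/-- The vertices of `S` at distance at most `j` from `B`. -/
noncomputable def reach (H : SimpleGraph V) (S B : Finset V) : ℕ → Finset V
  | 0 => B
  | j + 1 => reach H S B j ∪ (reach H S B j).biUnion (nbrOn H S)

/-- The vertices of `S` at distance exactly `j` from `B`. -/
noncomputable def layer (H : SimpleGraph V) (S B : Finset V) : ℕ → Finset V
  | 0 => B
  | j + 1 => reach H S B (j + 1) \ reach H S B j

theorem reach_mono (H : SimpleGraph V) (S B : Finset V) : Monotone (reach H S B) :=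
  monotone_nat_of_le_succ fun _ => subset_union_left

theorem reach_subset {H : SimpleGraph V} {S B : Finset V} (hB : B ⊆ S) (j : ℕ) :
    reach H S B j ⊆ S := by
  induction j with
  | zero => exact hB
  | succ j ih => exact union_subset ih (biUnion_subset.2 fun u _ => nbrOn_subset _ _ _)

theorem layer_subset_reach (H : SimpleGraph V) (S B : Finset V) (j : ℕ) :
    layer H S B j ⊆ reach H S B j := by
  cases j with
  | zero => exact Subset.rfl
  | succ j => exact sdiff_subset

theorem mem_reach_succ {H : SimpleGraph V} {S B : Finset V} {j : ℕ} {u v : V}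
    (hu : u ∈ reach H S B j) (hv : v ∈ S) (h : H.Adj u v) : v ∈ reach H S B (j + 1) :=
  mem_union_right _ (mem_biUnion.2 ⟨u, hu, mem_nbrOn.2 ⟨hv, h⟩⟩)

theorem exists_adj_of_mem_layer_succ {H : SimpleGraph V} {S B : Finset V} {j : ℕ} {v : V}
    (hB : B ⊆ S) (hv : v ∈ layer H S B (j + 1)) : ∃ u ∈ layer H S B j, H.Adj u v := by
  have h := mem_sdiff.1 hv
  have h1 := h.1
  rw [reach, mem_union, mem_biUnion] at h1
  obtain ⟨u, hu, huv⟩ := h1.resolve_left h.2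
  refine ⟨u, ?_, (mem_nbrOn.1 huv).2⟩
  cases j with
  | zero => exact hu
  | succ j =>
    exact mem_sdiff.2 ⟨hu, fun hu' => h.2 (mem_reach_succ hu' (reach_subset hB _ h.1)
      (mem_nbrOn.1 huv).2)⟩

theorem layer_index_unique {H : SimpleGraph V} {S B : Finset V} {i j : ℕ} {v : V}
    (hi : v ∈ layer H S B i) (hj : v ∈ layer H S B j) : i = j := by
  have key : ∀ i j, i < j → v ∈ layer H S B i → v ∉ layer H S B j := by
    intro i j hij hi hj
    obtain ⟨j, rfl⟩ : ∃ j', j = j' + 1 := ⟨j - 1, by omega⟩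
    exact (mem_sdiff.1 hj).2 (reach_mono H S B (by omega) (layer_subset_reach _ _ _ _ hi))
  rcases lt_trichotomy i j with h | h | h
  · exact absurd hj (key i j h hi)
  · exact h
  · exact absurd hi (key j i h hj)

theorem exists_geodesic {H : SimpleGraph V} {S B : Finset V} (hB : B ⊆ S) (j : ℕ) :
    ∀ v ∈ layer H S B j, ∃ p : ℕ → V, p j = v ∧ (∀ i ≤ j, p i ∈ layer H S B i) ∧
      ∀ i < j, H.Adj (p i) (p (i + 1)) := by
  induction j with
  | zero =>
    intro v hv
    exact ⟨fun _ => v, rfl, fun i hi => by rwa [Nat.le_zero.1 hi], by simp⟩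
  | succ j ih =>
    intro v hv
    obtain ⟨u, hu, huv⟩ := exists_adj_of_mem_layer_succ hB hv
    obtain ⟨p, hpj, hp, hadj⟩ := ih u hu
    refine ⟨fun i => if i = j + 1 then v else p i, by simp, ?_, ?_⟩
    · intro i hi
      by_cases h : i = j + 1
      · simpa [h] using hv
      · simpa [h] using hp i (by omega)
    · intro i hi
      by_cases h : i = j
      · subst h; simpa [hpj] using huv
      · have h1 : ¬ i = j + 1 := by omega
        simpa [h, h1] using hadj i (by omega)

/-- Beyond `B` all degrees are two, and one neighbour is spent on the previous layer. So each vertex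
has at most one successor and layers do not grow after the first. -/
theorem card_layer_le {H : SimpleGraph V} {S B : Finset V} (hB : B ⊆ S)
    (hd : ∀ v ∈ S, v ∉ B → degOn H S v = 2) (j : ℕ) :
    #(layer H S B (j + 1)) ≤ ∑ v ∈ B, degOn H S v := by
  induction j with
  | zero =>
    refine (card_le_card fun v hv => ?_).trans (card_biUnion_le (s := B) (t := nbrOn H S))
    obtain ⟨u, hu, huv⟩ := exists_adj_of_mem_layer_succ hB hv
    exact mem_biUnion.2 ⟨u, hu, mem_nbrOn.2
      ⟨reach_subset hB _ (layer_subset_reach _ _ _ _ hv), huv⟩⟩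
  | succ j ih =>
    refine le_trans ?_ ih
    have h1 : layer H S B (j + 2) ⊆
        (layer H S B (j + 1)).biUnion fun u => nbrOn H S u \ reach H S B j := by
      intro v hv
      obtain ⟨u, hu, huv⟩ := exists_adj_of_mem_layer_succ hB hv
      refine mem_biUnion.2 ⟨u, hu, mem_sdiff.2 ⟨mem_nbrOn.2
        ⟨reach_subset hB _ (layer_subset_reach _ _ _ _ hv), huv⟩, fun h => ?_⟩⟩
      exact (mem_sdiff.1 hv).2 (reach_mono H S B (Nat.le_succ j) h)
    have h2 : ∀ u ∈ layer H S B (j + 1), #(nbrOn H S u \ reach H S B j) ≤ 1 := by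
      intro u hu
      have huS := reach_subset hB _ (layer_subset_reach _ _ _ _ hu)
      have huB : u ∉ B := fun h => by
        have := layer_index_unique (i := 0) (show u ∈ layer H S B 0 from h) hu
        omega
      have h3 : #(nbrOn H S u) = 2 := hd u huS huB
      obtain ⟨w, hw, hwu⟩ := exists_adj_of_mem_layer_succ hB hu
      have hw' := layer_subset_reach _ _ _ _ hw
      have h4 : nbrOn H S u \ reach H S B j ⊂ nbrOn H S u := by
        refine Finset.ssubset_iff_subset_ne.2 ⟨sdiff_subset, fun h => ?_⟩
        have : w ∈ nbrOn H S u := mem_nbrOn.2 ⟨reach_subset hB _ hw', hwu.symm⟩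
        rw [← h] at this
        exact (mem_sdiff.1 this).2 hw'
      have := card_lt_card h4
      omega
    simpa using (card_le_card h1).trans (card_biUnion_le_card_mul _ _ 1 h2)

theorem card_reach_le {H : SimpleGraph V} {S B : Finset V} (hB : B ⊆ S)
    (hd : ∀ v ∈ S, v ∉ B → degOn H S v = 2) (j : ℕ) :
    #(reach H S B j) ≤ #B + j * ∑ v ∈ B, degOn H S v := by
  induction j with
  | zero => simp [reach]
  | succ j ih =>
    have h1 : reach H S B (j + 1) = reach H S B j ∪ layer H S B (j + 1) :=
      (union_sdiff_of_subset (reach_mono H S B (Nat.le_succ j))).symm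
    have h2 := card_layer_le hB hd j
    rw [h1]
    have h3 := card_union_le (reach H S B j) (layer H S B (j + 1))
    rw [add_mul, one_mul]
    omega

/-- The ball of radius `q` around `B` is too small to be `S`, so some vertex is at distance `q + 1`.
The inner vertices of a geodesic to it lie outside `B` and have degree two. -/
theorem exists_suspOn_of_card_lt {H : SimpleGraph V} {S B : Finset V} (hS : ConnOn H S)
    (hB : B ⊆ S) (hne : B.Nonempty) (hd : ∀ v ∈ S, v ∉ B → degOn H S v = 2) {q : ℕ}
    (hq : #B + q * ∑ v ∈ B, degOn H S v < #S) : ∃ p, SuspOn H S p q := by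
  have h1 := card_reach_le hB hd q
  obtain ⟨u, hu, v, hv, hvr, huv⟩ := hS (reach H S B q) (reach_subset hB q)
    (hne.mono (reach_mono H S B (Nat.zero_le q))) (by rintro h; rw [h] at h1; omega)
  have hvl : v ∈ layer H S B (q + 1) := mem_sdiff.2 ⟨mem_reach_succ hu hv huv, hvr⟩
  obtain ⟨p, -, hp, hadj⟩ := exists_geodesic hB (q + 1) v hvl
  have hmem : ∀ i ≤ q + 1, p i ∈ S := fun i hi =>
    reach_subset hB _ (layer_subset_reach _ _ _ _ (hp i hi))
  have hinj : ∀ i ≤ q + 1, ∀ j ≤ q + 1, p i = p j → i = j := fun i hi j hj h =>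
    layer_index_unique (hp i hi) (h ▸ hp j hj)
  refine ⟨p, hmem, hinj, fun i hi => hadj i (by omega), ?_⟩
  intro i h1 h2 u hu hiu
  have hiB : p i ∉ B := fun h => by
    have := layer_index_unique (i := 0) (show p i ∈ layer H S B 0 from h) (hp i (by omega))
    omega
  have hdeg : #(nbrOn H S (p i)) = 2 := hd _ (hmem i (by omega)) hiB
  have hne : p (i - 1) ≠ p (i + 1) := fun h => by
    have := hinj _ (by omega) _ (by omega) h
    omega
  have hsub : ({p (i - 1), p (i + 1)} : Finset V) ⊆ nbrOn H S (p i) := by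
    have h3 := hadj (i - 1) (by omega)
    rw [Nat.sub_add_cancel h1] at h3
    rw [insert_subset_iff, singleton_subset_iff, mem_nbrOn, mem_nbrOn]
    exact ⟨⟨hmem _ (by omega), h3.symm⟩, hmem _ (by omega), hadj i (by omega)⟩
  have heq := eq_of_subset_of_card_le hsub (by rw [hdeg, card_pair hne])
  have : u ∈ nbrOn H S (p i) := mem_nbrOn.2 ⟨hu, hiu⟩
  rw [← heq] at this
  simpa using this

/-- A connected graph with few vertices of degree one and few cycles has a long suspended path. -/
theorem ConnOn.exists_suspOn {H : SimpleGraph V} {S : Finset V} (hS : ConnOn H S) {l b q : ℕ}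
    (hl : degSum H S ≤ 2 * (#S + l)) (h2 : 2 ≤ #S) (hb : #{v ∈ S | degOn H S v ≤ 1} ≤ b)
    (hq : (2 * l + 2 * b + 1) + q * (6 * l + 4 * b + 2) < #S) : ∃ p, SuspOn H S p q := by
  -- The extra vertex `v0` keeps the set of centres nonempty when all degrees are two, as in a
  -- cycle. It accounts for the `+ 1` and `+ 2` in the bounds.
  obtain ⟨v0, hv0⟩ := card_pos.1 (show 0 < #S by omega)
  set C := S.filter fun v => degOn H S v ≠ 2 with hC
  have hsum : ∀ a : ℕ, ∑ v ∈ S, (if degOn H S v ≤ 1 then a else 0) =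
      a * #{v ∈ S | degOn H S v ≤ 1} := by
    intro a
    rw [← sum_filter, sum_const, smul_eq_mul, mul_comm]
  have hmC : ∀ v ∈ S, v ∈ C ↔ degOn H S v ≠ 2 := fun v hv => by simp [hC, hv]
  have hSC : S ∩ C = C := inter_eq_right.2 (filter_subset _ _)
  have hCc : #C + 2 * #S ≤ degSum H S + 2 * b := by
    have h : ∑ v ∈ S, ((if v ∈ C then 1 else 0) + 2) ≤
        ∑ v ∈ S, (degOn H S v + if degOn H S v ≤ 1 then 2 else 0) := by
      refine sum_le_sum fun v hv => ?_
      have := hS.one_le_degOn h2 hv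
      by_cases hvC : v ∈ C
      · have := (hmC v hv).1 hvC
        simp only [hvC, if_true]
        split_ifs <;> omega
      · have : degOn H S v = 2 := by_contra fun h => hvC ((hmC v hv).2 h)
        simp only [hvC, if_false]
        split_ifs <;> omega
    rw [sum_add_distrib, sum_add_distrib, hsum, sum_ite_mem, hSC, sum_const, sum_const,
      smul_eq_mul, smul_eq_mul] at h
    unfold degSum at *
    omega
  -- Pointwise, a vertex of degree `d ≥ 3` satisfies `d + 6 ≤ 3d`, one of degree 2 gives `6 ≤ 6`,
  -- and a leaf gives `1 + 6 ≤ 3 + 4`.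
  have hCs : ∑ v ∈ C, degOn H S v + 6 * #S ≤ 3 * degSum H S + 4 * b := by
    have h : ∑ v ∈ S, ((if v ∈ C then degOn H S v else 0) + 6) ≤
        ∑ v ∈ S, (3 * degOn H S v + if degOn H S v ≤ 1 then 4 else 0) := by
      refine sum_le_sum fun v hv => ?_
      have := hS.one_le_degOn h2 hv
      by_cases hvC : v ∈ C
      · have := (hmC v hv).1 hvC
        simp only [hvC, if_true]
        split_ifs <;> omega
      · have : degOn H S v = 2 := by_contra fun h => hvC ((hmC v hv).2 h)
        simp only [hvC, if_false]
        split_ifs <;> omega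
    rw [sum_add_distrib, sum_add_distrib, hsum, sum_ite_mem, hSC, ← mul_sum, sum_const,
      smul_eq_mul] at h
    unfold degSum at *
    omega
  have hBc : #(insert v0 C) ≤ 2 * l + 2 * b + 1 := by
    have := card_insert_le v0 C
    omega
  have hBs : ∑ v ∈ insert v0 C, degOn H S v ≤ 6 * l + 4 * b + 2 := by
    by_cases h : v0 ∈ C
    · rw [insert_eq_of_mem h]; omega
    · rw [sum_insert h]
      have : degOn H S v0 = 2 := by
        by_contra h'; exact h (mem_filter.2 ⟨hv0, h'⟩)
      omega
  refine exists_suspOn_of_card_lt hS (insert_subset hv0 (filter_subset _ _)) (insert_nonempty _ _)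
    (fun v hv hvB => ?_) (lt_of_le_of_lt (Nat.add_le_add hBc (Nat.mul_le_mul_left q hBs)) hq)
  by_contra h
  exact hvB (mem_insert_of_mem (mem_filter.2 ⟨hv, h⟩))

/-- The path left when the first inner vertex is contracted. -/
def shortcut (p : ℕ → V) (i : ℕ) : V := if i = 0 then p 0 else p (i + 1)

theorem SuspOn.shortcut {H : SimpleGraph V} {S : Finset V} {p : ℕ → V} {q : ℕ}
    (h : SuspOn H S p (q + 1)) :
    SuspOn (H ⊔ SimpleGraph.edge (p 0) (p 2)) (S.erase (p 1)) (shortcut p) q := by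
  have h02 : p 0 ≠ p 2 := fun e => by have := h.inj 0 (by omega) 2 (by omega) e; omega
  have ne1 : ∀ i ≤ q + 2, i ≠ 1 → p i ≠ p 1 := fun i hi h1 e =>
    h1 (h.inj i (by omega) 1 (by omega) e)
  refine ⟨?_, ?_, ?_, ?_⟩
  · intro i hi
    unfold BookRamsey.shortcut
    split_ifs with h0
    · exact mem_erase.2 ⟨ne1 0 (by omega) (by omega), h.mem 0 (by omega)⟩
    · exact mem_erase.2 ⟨ne1 _ (by omega) (by omega), h.mem _ (by omega)⟩
  · intro i hi j hj
    unfold BookRamsey.shortcut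
    split_ifs with h0 h1 h1 <;> intro e
    · omega
    · have := h.inj _ (by omega) _ (by omega) e; omega
    · have := h.inj _ (by omega) _ (by omega) e; omega
    · have := h.inj _ (by omega) _ (by omega) e; omega
  · intro i hi
    unfold BookRamsey.shortcut
    by_cases h0 : i = 0
    · subst h0
      right
      simp [SimpleGraph.edge_adj, h02]
    · left
      simpa [h0] using h.adj (i + 1) (by omega)
  · intro i h1 h2 u hu hadj
    have h0 : i ≠ 0 := by omega
    obtain ⟨hu1, huS⟩ := mem_erase.1 hu
    simp only [BookRamsey.shortcut, h0, if_false] at hadj ⊢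
    simp only [Nat.succ_ne_zero, if_false]
    rcases hadj with hadj | hadj
    · rcases h.nbr (i + 1) (by omega) (by omega) u huS hadj with e | e
      · by_cases hi : i = 1
        · subst hi; exact absurd e hu1
        · left
          rw [if_neg (by omega), e]
          congr 1; omega
      · exact Or.inr e
    · rw [SimpleGraph.edge_adj] at hadj
      rcases hadj.1 with ⟨e1, e2⟩ | ⟨e1, e2⟩
      · have := h.inj _ (by omega) _ (by omega) e1; omega
      · have := h.inj _ (by omega) _ (by omega) e1
        left
        rw [if_pos (by omega), e2]

theorem SuspOn.connOn_shortcut {H : SimpleGraph V} {S : Finset V} {p : ℕ → V} {q : ℕ}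
    (h : SuspOn H S p (q + 1)) (hS : ConnOn H S) :
    ConnOn (H ⊔ SimpleGraph.edge (p 0) (p 2)) (S.erase (p 1)) := by
  have ne : ∀ i ≤ q + 2, ∀ j ≤ q + 2, i ≠ j → p i ≠ p j := fun i hi j hj hij e =>
    hij (h.inj i (by omega) j (by omega) e)
  exact hS.contract (h.mem 0 (by omega)) (h.mem 1 (by omega)) (h.mem 2 (by omega))
    (ne _ (by omega) _ (by omega) (by omega)) (ne _ (by omega) _ (by omega) (by omega))
    (ne _ (by omega) _ (by omega) (by omega)) (h.nbr 1 le_rfl (by omega))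

/-- Contraction removes one vertex and at least two edges and adds at most one edge, so the excess
does not increase. -/
theorem SuspOn.degSum_shortcut {H : SimpleGraph V} {S : Finset V} {p : ℕ → V} {q : ℕ}
    (h : SuspOn H S p (q + 1)) {l : ℕ} (hS : degSum H S ≤ 2 * (#S + l)) :
    degSum (H ⊔ SimpleGraph.edge (p 0) (p 2)) (S.erase (p 1)) ≤ 2 * (#(S.erase (p 1)) + l) := by
  have h02 : p 0 ≠ p 2 := fun e => by have := h.inj 0 (by omega) 2 (by omega) e; omega
  have h1 := degSum_sup_edge_le H (S.erase (p 1)) h02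
  have hm := h.mem 1 (by omega)
  have h2 := degSum_erase H hm
  have h3 : #(S.erase (p 1)) + 1 = #S := card_erase_add_one hm
  have h4 : #({p 0, p 2} : Finset V) ≤ degOn H S (p 1) := by
    refine card_le_card ?_
    rw [insert_subset_iff, singleton_subset_iff, mem_nbrOn, mem_nbrOn]
    exact ⟨⟨h.mem 0 (by omega), (h.adj 0 (by omega)).symm⟩, h.mem 2 (by omega), h.adj 1 (by omega)⟩
  rw [card_pair h02] at h4
  omega

end Suspended

/-! ### Blue books, matchings and vertex covers. -/

section Books

variable {V W : Type*}

theorem exists_injective_of_card_le {ι : Type*} [Fintype ι] (C : ι → Finset W)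
    (h : ∀ i, Fintype.card ι ≤ #(C i)) : ∃ g : ι → W, Function.Injective g ∧ ∀ i, g i ∈ C i := by
  refine (all_card_le_biUnion_card_iff_exists_injective C).1 fun s => ?_
  rcases s.eq_empty_or_nonempty with rfl | ⟨i, hi⟩
  · simp
  · exact (card_le_univ s).trans ((h i).trans (card_le_card (subset_biUnion_of_mem C hi)))

theorem copies_isContained_iff {X : Type*} {H : SimpleGraph X} {B : SimpleGraph W} {t : ℕ} :
    copies t H ⊑ B ↔ ∃ F : Fin t → X → W, (∀ i a j b, F i a = F j b → i = j ∧ a = b) ∧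
      ∀ i a b, H.Adj a b → B.Adj (F i a) (F i b) := by
  constructor
  · rintro ⟨f, hf⟩
    refine ⟨fun i a => f (i, a), fun i a j b h => ?_, fun i a b h => ?_⟩
    · simpa using hf h
    · exact f.map_adj (show (copies t H).Adj (i, a) (i, b) from ⟨rfl, h⟩)
  · rintro ⟨F, hinj, hadj⟩
    refine ⟨⟨⟨fun p => F p.1 p.2, ?_⟩, ?_⟩⟩
    · rintro ⟨i, a⟩ ⟨j, b⟩ ⟨h1, h2⟩
      obtain rfl : i = j := h1
      exact hadj i a b h2
    · rintro ⟨i, a⟩ ⟨j, b⟩ h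
      exact Prod.ext_iff.2 (hinj i a j b h)

theorem adj_of_book_adj {B : SimpleGraph W} {k : ℕ} {g : Fin 2 ⊕ Fin k → W}
    (h01 : B.Adj (g (Sum.inl 0)) (g (Sum.inl 1)))
    (h : ∀ i j, B.Adj (g (Sum.inl i)) (g (Sum.inr j))) {a b : Fin 2 ⊕ Fin k}
    (hab : (book k).Adj a b) : B.Adj (g a) (g b) := by
  rcases a with a | a <;> rcases b with b | b
  · have : a ≠ b := by simpa [book, join] using hab
    fin_cases a <;> fin_cases b <;> simp_all [h01.symm]
  · exact h a b
  · exact (h b a).symm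
  · simp [book, join] at hab

/-- `t` disjoint edges inside `A`. -/
def HasMatching (B : SimpleGraph W) (A : Finset W) (t : ℕ) : Prop :=
  ∃ x y : Fin t → W, (∀ i, x i ∈ A ∧ y i ∈ A ∧ B.Adj (x i) (y i)) ∧
    Function.Injective (Sum.elim x y)

theorem HasMatching.mono {B : SimpleGraph W} {A A' : Finset W} {t : ℕ} (h : HasMatching B A t)
    (hA : A ⊆ A') : HasMatching B A' t := by
  obtain ⟨x, y, h, hi⟩ := h
  exact ⟨x, y, fun i => ⟨hA (h i).1, hA (h i).2.1, (h i).2.2⟩, hi⟩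

/-- Each candidate set has room for the pages of all `t` books together, so the pages can be chosen
distinct. The candidate sets themselves may overlap or coincide. -/
theorem copies_book_isContained {B : SimpleGraph W} {t k : ℕ} {x y : Fin t → W}
    (hxy : ∀ i, B.Adj (x i) (y i)) (hinj : Function.Injective (Sum.elim x y))
    (C : Fin t → Finset W) (hC : ∀ i, t * k ≤ #(C i))
    (hadj : ∀ i, ∀ w ∈ C i, B.Adj (x i) w ∧ B.Adj (y i) w)
    (hdisj : ∀ i, ∀ w ∈ C i, ∀ j, w ≠ x j ∧ w ≠ y j) : copies t (book k) ⊑ B := by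
  obtain ⟨g, hg, hgC⟩ := exists_injective_of_card_le (fun p : Fin t × Fin k => C p.1)
    (fun p => by simpa using hC p.1)
  have hx : ∀ i j, x i = x j → i = j := fun i j h => by
    simpa using @hinj (Sum.inl i) (Sum.inl j) h
  have hy : ∀ i j, y i = y j → i = j := fun i j h => by
    simpa using @hinj (Sum.inr i) (Sum.inr j) h
  have hxy' : ∀ i j, x i ≠ y j := fun i j h => by
    simpa using @hinj (Sum.inl i) (Sum.inr j) h
  have hp : ∀ i a j, g (i, a) ≠ x j ∧ g (i, a) ≠ y j := fun i a j => hdisj i _ (hgC (i, a)) j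
  refine copies_isContained_iff.2
    ⟨fun i => Sum.elim ![x i, y i] (fun a => g (i, a)), ?_, fun i a b hab => ?_⟩
  · rintro i (a | a) j (b | b) h
    · fin_cases a <;> fin_cases b
      · exact ⟨hx i j (by simpa using h), rfl⟩
      · exact absurd h (by simpa using hxy' i j)
      · exact absurd h.symm (by simpa using hxy' j i)
      · exact ⟨hy i j (by simpa using h), rfl⟩
    · fin_cases a
      · exact absurd h.symm (by simpa using (hp j b i).1)
      · exact absurd h.symm (by simpa using (hp j b i).2)
    · fin_cases b
      · exact absurd h (by simpa using (hp i a j).1)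
      · exact absurd h (by simpa using (hp i a j).2)
    · have := hg (show g (i, a) = g (j, b) from h)
      simp only [Prod.mk.injEq] at this
      exact ⟨this.1, by rw [this.2]⟩
  · refine adj_of_book_adj (by simpa using hxy i) (fun c j => ?_) hab
    have := hadj i _ (hgC (i, j))
    fin_cases c
    · simpa using this.1
    · simpa using this.2

/-- The endpoints of a maximal matching meet every edge. -/
theorem exists_cover_of_no_matching (B : SimpleGraph W) (A : Finset W) (t : ℕ) :
    HasMatching B A t ∨ ∃ C ⊆ A, #C ≤ 2 * (t - 1) ∧
      ∀ x ∈ A, ∀ y ∈ A, B.Adj x y → x ∈ C ∨ y ∈ C := by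
  induction t with
  | zero => exact Or.inl ⟨Fin.elim0, Fin.elim0, fun i => i.elim0, fun i => by
      rcases i with i | i <;> exact i.elim0⟩
  | succ t ih =>
    rcases ih with ⟨x, y, h, hinj⟩ | ⟨C, hC, hCc, hcov⟩
    · by_cases hcov : ∀ a ∈ A, ∀ b ∈ A, B.Adj a b →
          a ∈ univ.image (Sum.elim x y) ∨ b ∈ univ.image (Sum.elim x y)
      · refine Or.inr ⟨univ.image (Sum.elim x y), ?_, ?_, hcov⟩
        · intro w hw
          obtain ⟨i | i, -, rfl⟩ := mem_image.1 hw
          · exact (h i).1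
          · exact (h i).2.1
        · refine card_image_le.trans ?_
          simp; omega
      · push Not at hcov
        obtain ⟨a, ha, b, hb, hab, h1, h2⟩ := hcov
        have ha' : ∀ i, x i ≠ a ∧ y i ≠ a := fun i =>
          ⟨fun e => h1 (mem_image.2 ⟨Sum.inl i, mem_univ _, e⟩),
            fun e => h1 (mem_image.2 ⟨Sum.inr i, mem_univ _, e⟩)⟩
        have hb' : ∀ i, x i ≠ b ∧ y i ≠ b := fun i =>
          ⟨fun e => h2 (mem_image.2 ⟨Sum.inl i, mem_univ _, e⟩),
            fun e => h2 (mem_image.2 ⟨Sum.inr i, mem_univ _, e⟩)⟩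
        have hx : ∀ i j, x i = x j → i = j := fun i j h => by
          simpa using @hinj (Sum.inl i) (Sum.inl j) h
        have hy : ∀ i j, y i = y j → i = j := fun i j h => by
          simpa using @hinj (Sum.inr i) (Sum.inr j) h
        have hxy' : ∀ i j, x i ≠ y j := fun i j h => by
          simpa using @hinj (Sum.inl i) (Sum.inr j) h
        refine Or.inl ⟨Fin.cons a x, Fin.cons b y, fun i => ?_, ?_⟩
        · refine Fin.cases ?_ (fun i => ?_) i
          · exact ⟨ha, hb, hab⟩
          · exact h i
        · rintro (i | i) (j | j) e <;> simp only [Sum.elim_inl, Sum.elim_inr] at e <;>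
            refine Fin.cases ?_ (fun i => ?_) i e <;> refine Fin.cases ?_ (fun j => ?_) j <;>
            intro e <;> simp only [Fin.cons_zero, Fin.cons_succ] at e
          · rfl
          · exact absurd e.symm (ha' j).1
          · exact absurd e (ha' i).1
          · rw [hx i j e]
          · exact absurd e hab.ne
          · exact absurd e.symm (ha' j).2
          · exact absurd e (hb' i).1
          · exact absurd e (hxy' i j)
          · exact absurd e.symm hab.ne
          · exact absurd e.symm (hb' j).1
          · exact absurd e (ha' i).2
          · exact absurd e.symm (hxy' j i)
          · rfl
          · exact absurd e.symm (hb' j).2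
          · exact absurd e (hb' i).2
          · rw [hy i j e]
    · exact Or.inr ⟨C, hC, by omega, hcov⟩

/-- Of the `2t` candidates for a partner, at most `t` lie in `T` itself, and `t` others suffice for
distinct choices. -/
theorem hasMatching_of_forall_le {B : SimpleGraph W} {A T : Finset W} {t : ℕ}
    (hTc : #T = t) {C : W → Finset W} (hC : ∀ h ∈ T, C h ⊆ nbrOn B A h)
    (hc : ∀ h ∈ T, 2 * t ≤ #(C h)) :
    ∃ x y : Fin t → W, (∀ i, x i ∈ T ∧ y i ∈ C (x i) ∧ B.Adj (x i) (y i)) ∧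
      Function.Injective (Sum.elim x y) := by
  let e := (T.equivFinOfCardEq hTc).symm
  obtain ⟨g, hg, hgC⟩ := exists_injective_of_card_le (fun i : Fin t => C (e i) \ T) (fun i => by
    have h1 := hc _ (e i).2
    have h2 := le_card_sdiff T (C (e i))
    simp only [Fintype.card_fin]
    omega)
  have hgT : ∀ i, g i ∉ T := fun i => (mem_sdiff.1 (hgC i)).2
  refine ⟨fun i => e i, g, fun i => ?_, ?_⟩
  · have := (mem_sdiff.1 (hgC i)).1
    exact ⟨(e i).2, this, (mem_nbrOn.1 (hC _ (e i).2 this)).2⟩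
  · rintro (i | i) (j | j) h <;> simp only [Sum.elim_inl, Sum.elim_inr] at h
    · rw [e.injective (Subtype.ext h)]
    · exact absurd (h ▸ (e i).2) (hgT j)
    · exact absurd (h.symm ▸ (e j).2) (hgT i)
    · rw [hg h]

theorem exists_book_of_not_bookFreeOn {R : SimpleGraph W} {U : Finset W} {k : ℕ}
    (h : ¬ BookFreeOn R U k) : ∃ g : Fin 2 ⊕ Fin k → W, Function.Injective g ∧ (∀ a, g a ∈ U) ∧
      ∀ a b, (book k).Adj a b → Rᶜ.Adj (g a) (g b) := by
  unfold BookFreeOn at h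
  push Not at h
  obtain ⟨x, hx, y, hy, hxy, hk⟩ := h
  obtain ⟨P, hP, hPk⟩ := exists_subset_card_eq hk
  let e := (P.equivFinOfCardEq hPk).symm
  have he : ∀ i, ((e i : W) ∈ U ∧ Rᶜ.Adj x (e i)) ∧ Rᶜ.Adj y (e i) := fun i => by
    have := hP (e i).2
    rw [mem_inter, mem_nbrOn, mem_nbrOn] at this
    exact ⟨this.1, this.2.2⟩
  refine ⟨Sum.elim ![x, y] fun i => e i, ?_, ?_, fun a b hab => ?_⟩
  · rintro (a | a) (b | b) h
    · have := hxy.ne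
      fin_cases a <;> fin_cases b <;> simp_all
    · fin_cases a
      · exact absurd h (he b).1.2.ne
      · exact absurd h (he b).2.ne
    · fin_cases b
      · exact absurd h.symm (he a).1.2.ne
      · exact absurd h.symm (he a).2.ne
    · rw [e.injective (Subtype.ext h)]
  · rintro (a | a)
    · fin_cases a <;> simpa
    · exact (he a).1.1
  · refine adj_of_book_adj (by simpa using hxy) (fun c j => ?_) hab
    fin_cases c
    · exact (he j).1.2
    · exact (he j).2

/-- `Z` is the vertex set of a maximal family of disjoint blue books, which has at most `t - 1`
members. -/
theorem exists_bookFreeOn [Fintype W] (R : SimpleGraph W) (k t : ℕ) :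
    copies t (book k) ⊑ Rᶜ ∨ ∃ Z : Finset W, #Z ≤ (t - 1) * (k + 2) ∧ BookFreeOn R Zᶜ k := by
  induction t with
  | zero => exact Or.inl (copies_isContained_iff.2 ⟨Fin.elim0, fun i => i.elim0, fun i => i.elim0⟩)
  | succ t ih =>
    rcases ih with h | ⟨Z, hZ, hfree⟩
    · obtain ⟨F, hinj, hadj⟩ := copies_isContained_iff.1 h
      set Z := univ.image fun p : Fin t × (Fin 2 ⊕ Fin k) => F p.1 p.2 with hZdef
      by_cases hfree : BookFreeOn R Zᶜ k
      · refine Or.inr ⟨Z, card_image_le.trans ?_, hfree⟩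
        simp [add_comm]
      · left
        obtain ⟨g, hg, hgZ, hgadj⟩ := exists_book_of_not_bookFreeOn hfree
        have hgF : ∀ a i b, F i b ≠ g a := fun a i b e =>
          mem_compl.1 (hgZ a) (mem_image.2 ⟨(i, b), mem_univ _, e⟩)
        refine copies_isContained_iff.2 ⟨Fin.cons g F, fun i a j b => ?_, fun i a b hab => ?_⟩
        · refine Fin.cases ?_ (fun i => ?_) i <;> refine Fin.cases ?_ (fun j => ?_) j <;>
            intro e <;> simp only [Fin.cons_zero, Fin.cons_succ] at e
          · exact ⟨rfl, hg e⟩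
          · exact absurd e.symm (hgF _ _ _)
          · exact absurd e (hgF _ _ _)
          · obtain ⟨h1, h2⟩ := hinj _ _ _ _ e
            exact ⟨by rw [h1], h2⟩
        · refine Fin.cases ?_ (fun i => ?_) i
          · exact hgadj a b hab
          · exact hadj i a b hab
    · exact Or.inr ⟨Z, hZ.trans (Nat.mul_le_mul_right _ (by omega)), hfree⟩

theorem isContained_of_clique {X : Type*} [Fintype X] (H : SimpleGraph X) {B : SimpleGraph W}
    {K : Finset W} (hK : ∀ a ∈ K, ∀ b ∈ K, a ≠ b → B.Adj a b) (hc : Fintype.card X ≤ #K) :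
    H ⊑ B := by
  obtain ⟨g, hg, hgK⟩ := exists_injective_of_card_le (fun _ : X => K) fun _ => hc
  exact ⟨⟨⟨g, fun {a b} h => hK _ (hgK a) _ (hgK b) fun e => h.ne (hg e)⟩, hg⟩⟩

end Books

/-! ### Reinserting a contracted vertex into an embedded path. -/

section Lengthening

variable {V W : Type*}

/-- Inner vertices of a suspended path have no neighbours off the path, so its image may be replaced
by any red path `w` of the right length with the same ends that avoids the other images. -/
theorem SuspOn.embOn_of_path {H : SimpleGraph V} {S : Finset V} {p : ℕ → V} {q : ℕ}
    (h : SuspOn H S p (q + 1)) {R : SimpleGraph W} {U : Finset W} {f : V → W}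
    (hf : EmbOn (H ⊔ SimpleGraph.edge (p 0) (p 2)) R (S.erase (p 1)) U f) {w : ℕ → W}
    (h0 : w 0 = f (p 0)) (h1 : w (q + 2) = f (p (q + 2)))
    (hinj : ∀ i ≤ q + 2, ∀ j ≤ q + 2, w i = w j → i = j)
    (hadj : ∀ i ≤ q + 1, R.Adj (w i) (w (i + 1)))
    (hU : ∀ i, 1 ≤ i → i ≤ q + 1 → w i ∈ U)
    (hout : ∀ i, 1 ≤ i → i ≤ q + 1 → ∀ v ∈ S, (∀ j ≤ q + 2, v ≠ p j) → f v ≠ w i) :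
    ∃ g, EmbOn H R S U g := by
  have key : ∀ v, ∃ b, (∀ l ≤ q + 2, v = p l → b = w l) ∧ ((∀ l ≤ q + 2, v ≠ p l) → b = f v) := by
    intro v
    by_cases hv : ∃ l ≤ q + 2, v = p l
    · obtain ⟨l, hl, rfl⟩ := hv
      exact ⟨w l, fun m hm e => by rw [h.inj l (by omega) m (by omega) e],
        fun hne => absurd rfl (hne l hl)⟩
    · push Not at hv
      exact ⟨f v, fun l hl e => absurd e (hv l hl), fun _ => rfl⟩
  choose g hg1 hg2 using key
  have on : ∀ l ≤ q + 2, g (p l) = w l := fun l hl => hg1 _ l hl rfl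
  have ne1 : ∀ i ≤ q + 2, i ≠ 1 → p i ≠ p 1 := fun i hi h1 e =>
    h1 (h.inj i (by omega) 1 (by omega) e)
  have m0 : p 0 ∈ S.erase (p 1) := mem_erase.2 ⟨ne1 0 (by omega) (by omega), h.mem 0 (by omega)⟩
  have m2 : p (q + 2) ∈ S.erase (p 1) :=
    mem_erase.2 ⟨ne1 _ (by omega) (by omega), h.mem _ (by omega)⟩
  have mo : ∀ v ∈ S, (∀ l ≤ q + 2, v ≠ p l) → v ∈ S.erase (p 1) := fun v hv hne =>
    mem_erase.2 ⟨hne 1 (by omega), hv⟩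
  have endpt : ∀ i ≤ q + 2, (1 ≤ i ∧ i ≤ q + 1) ∨ (w i = f (p i) ∧ p i ∈ S.erase (p 1)) := by
    intro i hi
    by_cases a : i = 0
    · subst a; exact Or.inr ⟨h0, m0⟩
    by_cases b : i = q + 2
    · subst b; exact Or.inr ⟨h1, m2⟩
    · left; omega
  have off_ne : ∀ v ∈ S, (∀ l ≤ q + 2, v ≠ p l) → ∀ i ≤ q + 2, f v ≠ w i := by
    intro v hv hne i hi e
    rcases endpt i hi with ⟨a, b⟩ | ⟨a, b⟩
    · exact hout i a b v hv hne e
    · exact hne i hi (hf.inj v (mo v hv hne) _ b (e.trans a))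
  have cases_on : ∀ v, (∃ l ≤ q + 2, v = p l) ∨ ∀ l ≤ q + 2, v ≠ p l := fun v => by
    by_cases hv : ∃ l ≤ q + 2, v = p l
    · exact Or.inl hv
    · push Not at hv; exact Or.inr hv
  have on_off : ∀ i ≤ q + 2, ∀ v ∈ S, (∀ l ≤ q + 2, v ≠ p l) → H.Adj (p i) v →
      R.Adj (w i) (f v) := by
    intro i hi v hv hne hiv
    rcases endpt i hi with ⟨a, b⟩ | ⟨a, b⟩
    · rcases h.nbr i a b v hv hiv with e | e
      · exact absurd e (hne _ (by omega))
      · exact absurd e (hne _ (by omega))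
    · rw [a]; exact hf.adj _ b v (mo v hv hne) (Or.inl hiv)
  have inner : ∀ i, 1 ≤ i → i ≤ q + 1 → ∀ j ≤ q + 2, H.Adj (p i) (p j) → R.Adj (w i) (w j) := by
    intro i a b j hj hij
    rcases h.nbr i a b _ (h.mem j (by omega)) hij with e | e
    · have := h.inj j (by omega) _ (by omega) e
      subst this
      have := hadj (i - 1) (by omega)
      rw [Nat.sub_add_cancel a] at this
      exact this.symm
    · have := h.inj j (by omega) _ (by omega) e
      subst this
      exact hadj i b
  refine ⟨g, ?_, ?_, ?_⟩
  · intro u hu v hv e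
    rcases cases_on u with ⟨i, hi, rfl⟩ | hu' <;> rcases cases_on v with ⟨j, hj, rfl⟩ | hv'
    · rw [on i hi, on j hj] at e; rw [hinj i hi j hj e]
    · rw [on i hi, hg2 v hv'] at e; exact absurd e.symm (off_ne v hv hv' i hi)
    · rw [on j hj, hg2 u hu'] at e; exact absurd e (off_ne u hu hu' j hj)
    · rw [hg2 u hu', hg2 v hv'] at e; exact hf.inj u (mo u hu hu') v (mo v hv hv') e
  · intro v hv
    rcases cases_on v with ⟨i, hi, rfl⟩ | hv'
    · rw [on i hi]
      rcases endpt i hi with ⟨a, b⟩ | ⟨a, b⟩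
      · exact hU i a b
      · rw [a]; exact hf.mem _ b
    · rw [hg2 v hv']; exact hf.mem v (mo v hv hv')
  · intro u hu v hv e
    rcases cases_on u with ⟨i, hi, rfl⟩ | hu' <;> rcases cases_on v with ⟨j, hj, rfl⟩ | hv'
    · rw [on i hi, on j hj]
      rcases endpt i hi with ⟨a, b⟩ | ⟨a, b⟩
      · exact inner i a b j hj e
      rcases endpt j hj with ⟨c, d⟩ | ⟨c, d⟩
      · exact (inner j c d i hi e.symm).symm
      · rw [a, c]; exact hf.adj _ b _ d (Or.inl e)
    · rw [on i hi, hg2 v hv']; exact on_off i hi v hv hv' e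
    · rw [on j hj, hg2 u hu']; exact (on_off j hj u hu hu' e.symm).symm
    · rw [hg2 u hu', hg2 v hv']; exact hf.adj u (mo u hu hu') v (mo v hv hv') (Or.inl e)

/-- Insert `y` at position `c` of a red path whose other vertices are rearranged by `σ`. -/
theorem SuspOn.embOn_of_insertion {H : SimpleGraph V} {S : Finset V} {p : ℕ → V} {q : ℕ}
    (h : SuspOn H S p (q + 1)) {R : SimpleGraph W} {U : Finset W} {f : V → W}
    (hf : EmbOn (H ⊔ SimpleGraph.edge (p 0) (p 2)) R (S.erase (p 1)) U f) {y : W} (hyU : y ∈ U)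
    (hy : ∀ v ∈ S.erase (p 1), f v ≠ y) {c : ℕ} (hc1 : 1 ≤ c) (hc2 : c ≤ q + 1) {σ : ℕ → ℕ}
    (hσ0 : σ 0 = 0) (hσ1 : σ (q + 2) = q + 1) (hσ : ∀ i ≤ q + 2, σ i ≤ q + 1)
    (hσinj : ∀ i ≤ q + 2, ∀ j ≤ q + 2, i ≠ c → j ≠ c → σ i = σ j → i = j)
    (hl : R.Adj (f (BookRamsey.shortcut p (σ (c - 1)))) y)
    (hr : R.Adj y (f (BookRamsey.shortcut p (σ (c + 1)))))
    (hadj : ∀ i ≤ q + 1, i ≠ c → i + 1 ≠ c →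
      R.Adj (f (BookRamsey.shortcut p (σ i))) (f (BookRamsey.shortcut p (σ (i + 1))))) :
    ∃ g, EmbOn H R S U g := by
  have hs := h.shortcut
  refine h.embOn_of_path hf (w := fun i => if i = c then y else f (BookRamsey.shortcut p (σ i)))
    ?_ ?_ ?_ ?_ ?_ ?_
  · rw [if_neg (by omega), hσ0]; rfl
  · rw [if_neg (by omega), hσ1]; rfl
  · intro i hi j hj
    by_cases hic : i = c <;> by_cases hjc : j = c
    · intro _; omega
    · simp only [hic, hjc, if_true, if_false]
      intro e; exact absurd e.symm (hy _ (hs.mem _ (hσ j hj)))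
    · simp only [hic, hjc, if_true, if_false]
      intro e; exact absurd e (hy _ (hs.mem _ (hσ i hi)))
    · simp only [hic, hjc, if_false]
      intro e
      exact hσinj i hi j hj hic hjc (hs.inj _ (hσ i hi) _ (hσ j hj)
        (hf.inj _ (hs.mem _ (hσ i hi)) _ (hs.mem _ (hσ j hj)) e))
  · intro i hi
    by_cases hic : i = c
    · subst hic
      simpa using hr
    · by_cases hic' : i + 1 = c
      · have : i = c - 1 := by omega
        subst this
        simpa [hic, hic'] using hl
      · simpa [hic, hic'] using hadj i hi hic hic'
  · intro i h1 h2
    split_ifs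
    · exact hyU
    · exact hf.mem _ (hs.mem _ (hσ i (by omega)))
  · intro i h1 h2 v hv hne
    have hv1 : v ∈ S.erase (p 1) := mem_erase.2 ⟨hne 1 (by omega), hv⟩
    split_ifs
    · exact hy v hv1
    · intro e
      have e' := hf.inj _ hv1 _ (hs.mem _ (hσ i (by omega))) e
      have := hσ i (by omega)
      unfold BookRamsey.shortcut at e'
      split_ifs at e'
      · exact hne _ (by omega) e'
      · exact hne _ (by omega) e'

/-- Write the embedded path as `x 0, x 1, …`. If `y` is red to two consecutive vertices, it can be
inserted between them. If `y` is red to `x i` and `x j` and `x (i + 1)` is red to `x (j + 1)`, a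
rotation absorbs `y`. So `y` and the successors of its red neighbours form the blue clique. -/
theorem SuspOn.exists_embOn_or_blue_clique {H : SimpleGraph V} {S : Finset V} {p : ℕ → V} {q : ℕ}
    (h : SuspOn H S p (q + 1)) {R : SimpleGraph W} {U : Finset W} {f : V → W}
    (hf : EmbOn (H ⊔ SimpleGraph.edge (p 0) (p 2)) R (S.erase (p 1)) U f) {y : W} (hyU : y ∈ U)
    (hy : ∀ v ∈ S.erase (p 1), f v ≠ y) (hno : ¬ ∃ g, EmbOn H R S U g) :
    ∃ K : Finset W, (∀ a ∈ K, ∀ b ∈ K, a ≠ b → Rᶜ.Adj a b) ∧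
      #K = #{i ∈ range (q + 1) | R.Adj y (f (BookRamsey.shortcut p i))} + 1 := by
  have hs := h.shortcut
  set x : ℕ → W := fun i => f (BookRamsey.shortcut p i) with hx
  have hxinj : ∀ i ≤ q + 1, ∀ j ≤ q + 1, x i = x j → i = j := fun i hi j hj e =>
    hs.inj i hi j hj (hf.inj _ (hs.mem i hi) _ (hs.mem j hj) e)
  have hxadj : ∀ i ≤ q, R.Adj (x i) (x (i + 1)) := fun i hi =>
    hf.adj _ (hs.mem i (by omega)) _ (hs.mem _ (by omega)) (hs.adj i hi)
  have hxy : ∀ i ≤ q + 1, x i ≠ y := fun i hi => hy _ (hs.mem i hi)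
  have step1 : ∀ i ≤ q, R.Adj y (x i) → ¬ R.Adj y (x (i + 1)) := by
    intro i hi h1 h2
    refine hno (h.embOn_of_insertion hf hyU hy (c := i + 1) (by omega) (by omega)
      (σ := fun l => if l ≤ i then l else l - 1) (by simp) ?_ ?_ ?_ ?_ ?_ ?_)
    · rw [if_neg (by omega)]; omega
    · intro l hl; split_ifs <;> omega
    · intro a ha b hb hac hbc; split_ifs <;> omega
    · simpa using h1.symm
    · rw [if_neg (by omega)]; simpa using h2
    · intro l hl hlc hlc'
      by_cases hli : l < i
      · simp only [show l ≤ i by omega, show l + 1 ≤ i by omega, if_true]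
        exact hxadj l (by omega)
      · simp only [show ¬ l ≤ i by omega, show ¬ l + 1 ≤ i by omega, if_false]
        have := hxadj (l - 1) (by omega)
        rwa [show l - 1 + 1 = l + 1 - 1 by omega] at this
  have step2 : ∀ i j, i < j → j ≤ q → R.Adj y (x i) → R.Adj y (x j) →
      ¬ R.Adj (x (i + 1)) (x (j + 1)) := by
    intro i j hij hj h1 h2 h3
    -- The new path is `x 0, …, x i, y, x j, x (j - 1), …, x (i + 1), x (j + 1), …`, and `σ` encodes
    -- the reversed middle segment.
    refine hno (h.embOn_of_insertion hf hyU hy (c := i + 1) (by omega) (by omega)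
      (σ := fun l => if l ≤ i then l else if l ≤ j + 1 then j + i + 2 - l else l - 1)
      (by simp) ?_ ?_ ?_ ?_ ?_ ?_)
    · rw [if_neg (by omega), if_neg (by omega)]; omega
    · intro l hl; split_ifs <;> omega
    · intro a ha b hb hac hbc; split_ifs <;> omega
    · simpa using h1.symm
    · rw [if_neg (by omega), if_pos (by omega), show j + i + 2 - (i + 1 + 1) = j by omega]
      exact h2
    · intro l hl hlc hlc'
      by_cases hli : l < i
      · simp only [show l ≤ i by omega, show l + 1 ≤ i by omega, if_true]
        exact hxadj l (by omega)
      by_cases hlj : l ≤ j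
      · simp only [show ¬ l ≤ i by omega, show ¬ l + 1 ≤ i by omega, if_false,
          show l ≤ j + 1 by omega, show l + 1 ≤ j + 1 by omega, if_true]
        have := hxadj (j + i + 2 - (l + 1)) (by omega)
        rw [show j + i + 2 - (l + 1) + 1 = j + i + 2 - l by omega] at this
        exact this.symm
      by_cases hlj' : l = j + 1
      · subst hlj'
        simp only [show ¬ j + 1 ≤ i by omega, show ¬ j + 1 + 1 ≤ i by omega, if_false,
          le_refl, if_true, show ¬ j + 1 + 1 ≤ j + 1 by omega]
        rw [show j + i + 2 - (j + 1) = i + 1 by omega, show j + 1 + 1 - 1 = j + 1 by omega]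
        exact h3
      · simp only [show ¬ l ≤ i by omega, show ¬ l + 1 ≤ i by omega, if_false,
          show ¬ l ≤ j + 1 by omega, show ¬ l + 1 ≤ j + 1 by omega]
        have := hxadj (l - 1) (by omega)
        rwa [show l - 1 + 1 = l + 1 - 1 by omega] at this
  set I := {i ∈ range (q + 1) | R.Adj y (x i)} with hI
  have hIm : ∀ i ∈ I, i ≤ q ∧ R.Adj y (x i) := fun i hi => by
    rw [hI, mem_filter, mem_range] at hi; exact ⟨by omega, hi.2⟩
  have hyI : y ∉ I.image fun i => x (i + 1) := by
    intro hm
    obtain ⟨i, hi, e⟩ := mem_image.1 hm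
    exact hxy (i + 1) (by have := (hIm i hi).1; omega) e
  have hyadj : ∀ i ∈ I, Rᶜ.Adj y (x (i + 1)) := fun i hi => by
    have := hIm i hi
    rw [SimpleGraph.compl_adj]
    exact ⟨(hxy _ (by omega)).symm, step1 i this.1 this.2⟩
  refine ⟨insert y (I.image fun i => x (i + 1)), ?_, ?_⟩
  · intro a ha b hb hab
    rcases mem_insert.1 ha with rfl | ha <;> rcases mem_insert.1 hb with rfl | hb
    · exact absurd rfl hab
    · obtain ⟨j, hj, rfl⟩ := mem_image.1 hb
      exact hyadj j hj
    · obtain ⟨i, hi, rfl⟩ := mem_image.1 ha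
      exact (hyadj i hi).symm
    · obtain ⟨i, hi, rfl⟩ := mem_image.1 ha
      obtain ⟨j, hj, rfl⟩ := mem_image.1 hb
      rw [SimpleGraph.compl_adj]
      refine ⟨hab, ?_⟩
      have h1 := hIm i hi
      have h2 := hIm j hj
      rcases lt_trichotomy i j with hij | rfl | hij
      · exact step2 i j hij h2.1 h1.2 h2.2
      · exact absurd rfl hab
      · exact fun e => step2 j i hij h1.1 h2.2 h1.2 e.symm
  · rw [card_insert_of_notMem hyI, card_image_of_injOn]
    intro i hi j hj e
    have h1 := hIm i hi
    have h2 := hIm j hj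
    have := hxinj _ (by omega) _ (by omega) e
    omega

/-- A red copy of a graph with a shortened suspended path can be lengthened if there are `t`
disjoint blue edges outside it and no `t` disjoint blue books. -/
theorem SuspOn.exists_embOn_of_shortcut [Fintype W] {H : SimpleGraph V} {S : Finset V}
    {p : ℕ → V} {q : ℕ} (h : SuspOn H S p (q + 1)) {R : SimpleGraph W} {f : V → W}
    (hf : EmbOn (H ⊔ SimpleGraph.edge (p 0) (p 2)) R (S.erase (p 1)) univ f) {t k : ℕ}
    (hq : 3 * (t * k) + 4 * t ≤ q + 1) (hbook : ¬ copies t (book k) ⊑ Rᶜ)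
    (hM : HasMatching Rᶜ ((S.erase (p 1)).image f)ᶜ t) : ∃ g, EmbOn H R S univ g := by
  by_contra hno
  have hs := h.shortcut
  set x : ℕ → W := fun i => f (BookRamsey.shortcut p i) with hx
  have hxinj : ∀ i ≤ q + 1, ∀ j ≤ q + 1, x i = x j → i = j := fun i hi j hj e =>
    hs.inj i hi j hj (hf.inj _ (hs.mem i hi) _ (hs.mem j hj) e)
  have hxim : ∀ i ≤ q + 1, x i ∈ (S.erase (p 1)).image f := fun i hi =>
    mem_image_of_mem f (hs.mem i hi)
  have hred : ∀ y ∈ ((S.erase (p 1)).image f)ᶜ,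
      #{i ∈ range (q + 1) | R.Adj y (x i)} + 2 ≤ t * (k + 2) := by
    intro y hy
    obtain ⟨K, hK, hKc⟩ := h.exists_embOn_or_blue_clique hf (mem_univ y)
      (fun v hv e => mem_compl.1 hy (mem_image.2 ⟨v, hv, e⟩)) hno
    by_contra hlt
    refine hbook (isContained_of_clique _ hK ?_)
    rw [hKc]
    simp only [Fintype.card_prod, Fintype.card_sum, Fintype.card_fin]
    rw [add_comm 2 k]
    change _ ≤ #{i ∈ range (q + 1) | R.Adj y (x i)} + 1
    omega
  obtain ⟨a, b, hab, hinj⟩ := hM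
  -- Each end of a blue edge is red to at most `t(k + 2) - 2` of the `q + 1 ≥ 3tk + 4t` path
  -- vertices considered, so at least `tk` are blue to both ends and serve as pages.
  refine hbook (copies_book_isContained (fun i => (hab i).2.2) hinj
    (fun i => ((range (q + 1)).filter
      fun j => ¬ R.Adj (a i) (x j) ∧ ¬ R.Adj (b i) (x j)).image x) ?_ ?_ ?_)
  · intro i
    rw [card_image_of_injOn]
    · have h1 := hred _ (hab i).1
      have h2 := hred _ (hab i).2.1
      have h3 : range (q + 1) ⊆ ((range (q + 1)).filter
          fun j => ¬ R.Adj (a i) (x j) ∧ ¬ R.Adj (b i) (x j)) ∪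
          ({j ∈ range (q + 1) | R.Adj (a i) (x j)} ∪ {j ∈ range (q + 1) | R.Adj (b i) (x j)}) := by
        intro j hj
        simp only [mem_union, mem_filter]
        tauto
      have h4 := (card_le_card h3).trans ((card_union_le _ _).trans
        (Nat.add_le_add_left (card_union_le _ _) _))
      rw [card_range] at h4
      rw [mul_add] at h1 h2
      omega
    · intro j hj l hl e
      simp only [coe_filter, mem_range, Set.mem_ofPred_eq] at hj hl
      exact hxinj _ (by omega) _ (by omega) e
  · intro i w hw
    obtain ⟨j, hj, rfl⟩ := mem_image.1 hw
    rw [mem_filter, mem_range] at hj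
    have hm := hxim j (by omega)
    rw [SimpleGraph.compl_adj, SimpleGraph.compl_adj]
    exact ⟨⟨fun e => mem_compl.1 (hab i).1 (e ▸ hm), hj.2.1⟩,
      fun e => mem_compl.1 (hab i).2.1 (e ▸ hm), hj.2.2⟩
  · intro i w hw l
    obtain ⟨j, hj, rfl⟩ := mem_image.1 hw
    rw [mem_filter, mem_range] at hj
    have hm := hxim j (by omega)
    exact ⟨fun e => mem_compl.1 (hab l).1 (e ▸ hm), fun e => mem_compl.1 (hab l).2.1 (e ▸ hm)⟩

end Lengthening

/-! ### Embedding into about twice as many vertices without blue books. -/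

section WeakEmbedding

variable {V W : Type*}

theorem BookFreeOn.not_copies [Fintype W] {R : SimpleGraph W} {k : ℕ}
    (h : BookFreeOn R univ k) : ¬ copies 1 (book k) ⊑ Rᶜ := by
  intro hc
  obtain ⟨F, hinj, hadj⟩ := copies_isContained_iff.1 hc
  have h01 := hadj 0 (Sum.inl 0) (Sum.inl 1) (by simp [book, join])
  refine absurd (h _ (mem_univ _) _ (mem_univ _) h01) (not_lt.2 ?_)
  have hi : Function.Injective fun j : Fin k => F 0 (Sum.inr j) := fun a b e => by
    simpa using (hinj _ _ _ _ e).2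
  have hc := card_image_of_injective univ hi
  rw [card_univ, Fintype.card_fin] at hc
  refine hc.symm.le.trans (card_le_card fun w hw => ?_)
  obtain ⟨j, -, rfl⟩ := mem_image.1 hw
  simp only [mem_inter, mem_nbrOn]
  exact ⟨⟨mem_univ _, hadj 0 (Sum.inl 0) (Sum.inr j) (by simp [book, join])⟩, mem_univ _,
    hadj 0 (Sum.inl 1) (Sum.inr j) (by simp [book, join])⟩

/-- Induct on the number of vertices, using the greedy embedding while `S` is below about a third of
`W`. Above that, delete a leaf and put it back, or, if there are no leaves, contract a suspended
path and lengthen it with `t = 1`. When this fails, the vertices outside the image have small blue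
degree and leave room for `S` itself. -/
theorem ConnOn.exists_embOn_univ_of_bookFree [Fintype W] {R : SimpleGraph W} {k l : ℕ}
    (hk : 1 ≤ k) (hR : BookFreeOn R univ k) (hbig : 150 * (k * l) + 60 * k ≤ Fintype.card W)
    (m : ℕ) : ∀ (H : SimpleGraph V) (S : Finset V), #S = m → ConnOn H S →
    degSum H S ≤ 2 * (#S + l) → 2 * m + 2 * k ≤ Fintype.card W + 3 →
    ∃ f, EmbOn H R S univ f := by
  have hWne : Nonempty W := Fintype.card_pos_iff.1 (by omega)
  obtain ⟨d, rfl⟩ : ∃ d, k = d + 1 := ⟨k - 1, by omega⟩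
  have hl : l ≤ (d + 1) * l := Nat.le_mul_of_pos_left _ (by omega)
  have e1 : (d + 1 - 1) * (6 * l + 6) + 6 * l + 6 = 6 * ((d + 1) * l) + 6 * (d + 1) := by
    rw [Nat.add_sub_cancel]; ring
  have e2 : (d + 1 - 1) * (2 * l + 2) + 2 * l + 2 = 2 * ((d + 1) * l) + 2 * (d + 1) := by
    rw [Nat.add_sub_cancel]; ring
  have e3 : (3 * (d + 1) + 4) * (6 * l + 4 * 0 + 2) =
      18 * ((d + 1) * l) + 6 * (d + 1) + 24 * l + 8 := by ring
  generalize hP : (d + 1) * l = P at *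
  induction m with
  | zero =>
    intro H S hm _ _ _
    rw [card_eq_zero] at hm; subst hm
    exact ⟨fun _ => Classical.arbitrary W, by simp, by simp, by simp⟩
  | succ m ih =>
  intro H S hm hS hdeg hW
  have hsp := hS.sparse hdeg
  by_cases hsmall : 3 * #S + (d + 1 - 1) * (6 * l + 6) ≤ Fintype.card W
  · exact hsp.exists_embOn_of_bookFree hR S hsmall (by omega)
  -- Outside the greedy range, `S` is large enough to guarantee a suspended path with `3k + 4` inner
  -- vertices if it has no leaves.
  have hm48 : 48 * P + 18 * (d + 1) ≤ m + 1 := by omega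
  have hne : S.Nonempty := card_pos.1 (by omega)
  by_cases hleaf : ∃ v ∈ S, degOn H S v ≤ 1
  · obtain ⟨v, hv, hv1⟩ := hleaf
    have hcard : #(S.erase v) + 1 = #S := card_erase_add_one hv
    have hv1' := hS.one_le_degOn (by omega) hv
    have hds := degSum_erase H hv
    obtain ⟨f, hf⟩ := ih H (S.erase v) (by omega) (hS.erase hv hv1) (by omega) (by omega)
    obtain ⟨w, hw⟩ := card_eq_one.1 (show #(nbrOn H S v) = 1 from by unfold degOn at *; omega)
    have hw' : w ∈ nbrOn H S v := by rw [hw]; exact mem_singleton_self w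
    rw [mem_nbrOn] at hw'
    have hwS : w ∈ S.erase v := mem_erase.2 ⟨hw'.2.ne', hw'.1⟩
    by_cases hy : ∃ y, y ∉ (S.erase v).image f ∧ R.Adj (f w) y
    · obtain ⟨y, hy, hwy⟩ := hy
      have := hf.insert (notMem_erase v S) (mem_univ y)
        (fun u hu e => hy (mem_image.2 ⟨u, hu, e⟩)) (fun u hu hvu => by
          have : u ∈ nbrOn H S v := mem_nbrOn.2 ⟨mem_of_mem_erase hu, hvu⟩
          rw [hw, mem_singleton] at this
          subst this
          exact hwy.symm)
      rw [insert_erase hv] at this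
      exact ⟨_, this⟩
    -- All vertices outside the image are blue to the parent's image, so blue degrees there are at
    -- most `k - 1`. The size hypothesis leaves at least `#S + 2(k - 1)` of them.
    · push Not at hy
      have hA := hR.degOn_le (mem_univ (f w)) (A := ((S.erase v).image f)ᶜ) (subset_univ _)
        (fun a ha => by
          rw [mem_compl] at ha
          rw [SimpleGraph.compl_adj]
          exact ⟨fun e => ha (e ▸ mem_image_of_mem f hwS), hy a ha⟩)
      have hAc : #((S.erase v).image f)ᶜ + #(S.erase v) = Fintype.card W := by
        rw [← hf.card_image]; exact card_compl_add_card _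
      obtain ⟨g, hg⟩ := hsp.exists_embOn hA (by omega) (by omega) hne
      exact ⟨g, hg.mono Subset.rfl (subset_univ _)⟩
  · push Not at hleaf
    obtain ⟨p, hp⟩ := hS.exists_suspOn (b := 0) (q := 3 * (d + 1) + 4) hdeg (by omega)
      (by rw [Nat.le_zero, card_eq_zero, filter_eq_empty_iff]
          exact fun v hv => not_le.2 (hleaf v hv)) (by omega)
    have hp : SuspOn H S p ((3 * (d + 1) + 3) + 1) := hp
    have hcard : #(S.erase (p 1)) + 1 = #S := card_erase_add_one (hp.mem 1 (by omega))
    obtain ⟨f, hf⟩ := ih _ (S.erase (p 1)) (by omega) (hp.connOn_shortcut hS)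
      (hp.degSum_shortcut hdeg) (by omega)
    have hAc : #((S.erase (p 1)).image f)ᶜ + #(S.erase (p 1)) = Fintype.card W := by
      rw [← hf.card_image]; exact card_compl_add_card _
    rcases exists_cover_of_no_matching Rᶜ ((S.erase (p 1)).image f)ᶜ 1 with h | ⟨C, -, hC, hcov⟩
    · exact hp.exists_embOn_of_shortcut hf (by omega) hR.not_copies h
    -- An empty cover means that the vertices outside the image form a red clique.
    · rw [Nat.sub_self, Nat.le_zero, card_eq_zero] at hC
      subst hC
      obtain ⟨g, hg⟩ := hsp.exists_embOn (R := R) (A := ((S.erase (p 1)).image f)ᶜ) (d := 0)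
        (fun a ha => by
          rw [Nat.le_zero, degOn, card_eq_zero, eq_empty_iff_forall_notMem]
          intro b hb
          rw [mem_nbrOn] at hb
          simpa using hcov a ha b hb.1 hb.2) (by omega) (by omega) hne
      exact ⟨g, hg.mono Subset.rfl (subset_univ _)⟩

/-- A connected graph with few cycles embeds in red in about twice as many vertices if there is no
blue book. -/
theorem ConnOn.exists_embOn_of_bookFree {R : SimpleGraph W} {U : Finset W} {k l : ℕ}
    (hk : 1 ≤ k) (hR : BookFreeOn R U k) (hbig : 150 * (k * l) + 60 * k ≤ #U)
    {H : SimpleGraph V} {S : Finset V} (hS : ConnOn H S) (hdeg : degSum H S ≤ 2 * (#S + l))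
    (hc : 2 * #S + 2 * k ≤ #U + 3) : ∃ f, EmbOn H R S U f := by
  let R' : SimpleGraph U := R.comap Subtype.val
  have hcompl : ∀ x y : U, R'ᶜ.Adj x y → Rᶜ.Adj (x : W) y := by
    intro x y h
    rw [SimpleGraph.compl_adj] at h ⊢
    exact ⟨fun e => h.1 (Subtype.ext e), h.2⟩
  have hR' : BookFreeOn R' univ k := by
    intro x _ y _ hxy
    refine lt_of_le_of_lt ?_ (hR x x.2 y y.2 (hcompl x y hxy))
    rw [← card_map (Function.Embedding.subtype (· ∈ U))]
    refine card_le_card fun w hw => ?_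
    obtain ⟨z, hz, rfl⟩ := mem_map.1 hw
    simp only [mem_inter, mem_nbrOn] at hz ⊢
    exact ⟨⟨z.2, hcompl _ _ hz.1.2⟩, z.2, hcompl _ _ hz.2.2⟩
  obtain ⟨f, hf⟩ := ConnOn.exists_embOn_univ_of_bookFree (W := U) hk hR' (by simpa using hbig)
    #S H S rfl hS hdeg (by simpa using hc)
  exact ⟨fun v => f v, fun u hu v hv e => hf.inj u hu v hv (Subtype.ext e), fun v _ => (f v).2,
    fun u hu v hv e => hf.adj u hu v hv e⟩

end WeakEmbedding

/-! ### Using every vertex of an almost red clique. -/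

section Finishing

variable {V W : Type*}

theorem exists_independent (G : SimpleGraph V) (e : ℕ) :
    ∀ T : Finset V, (∀ v ∈ T, degOn G T v ≤ 2) → 3 * e ≤ #T →
    ∃ I ⊆ T, #I = e ∧ ∀ u ∈ I, ∀ v ∈ I, ¬ G.Adj u v := by
  induction e with
  | zero => exact fun T _ _ => ⟨∅, by simp⟩
  | succ e ih =>
    intro T hT hc
    obtain ⟨v, hv⟩ := card_pos.1 (show 0 < #T by omega)
    have hT' : T \ insert v (nbrOn G T v) ⊆ T := sdiff_subset
    have h1 : #(insert v (nbrOn G T v)) ≤ 3 :=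
      (card_insert_le _ _).trans (Nat.succ_le_succ (hT v hv))
    have h2 := le_card_sdiff (insert v (nbrOn G T v)) T
    obtain ⟨I, hI, hIc, hind⟩ := ih _ (fun u hu => (degOn_mono G hT' u).trans (hT u (hT' hu)))
      (by omega)
    have hvI : ∀ u ∈ I, u ≠ v ∧ ¬ G.Adj v u := fun u hu => by
      have h := mem_sdiff.1 (hI hu)
      simp only [mem_insert, mem_nbrOn, not_or] at h
      exact ⟨h.2.1, fun e => h.2.2 ⟨h.1, e⟩⟩
    refine ⟨insert v I, insert_subset hv (hI.trans hT'), ?_, ?_⟩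
    · rw [card_insert_of_notMem fun h => (hvI v h).1 rfl, hIc]
    · intro a ha b hb
      rcases mem_insert.1 ha with rfl | ha' <;> rcases mem_insert.1 hb with rfl | hb'
      · exact G.loopless.irrefl _
      · exact (hvI b hb').2
      · exact fun e => (hvI a ha').2 e.symm
      · exact hind a ha' b hb'

/-- Spanning embedding into a red clique with few exceptional vertices. -/
theorem exists_embOn_of_cover [Fintype V] {G : SimpleGraph V} {R : SimpleGraph W}
    {A X : Finset W} {d : ℕ} (hXA : X ⊆ A)
    (hcov : ∀ a ∈ A, ∀ b ∈ A, Rᶜ.Adj a b → a ∈ X ∨ b ∈ X) (hd : ∀ x ∈ X, degOn Rᶜ A x ≤ d)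
    (hn : Fintype.card V ≤ #A) (hlow : 3 * #X ≤ #{v | degOn G univ v ≤ 2})
    (hsize : 3 * #X + #X * d ≤ #A) : ∃ f, EmbOn G R univ A f := by
  obtain ⟨I, hI, hIc, hind⟩ := exists_independent G #X {v | degOn G univ v ≤ 2}
    (fun v hv => (degOn_mono G (subset_univ _) v).trans (mem_filter.1 hv).2) hlow
  let φ : I ≃ X := (I.equivFinOfCardEq hIc).trans (X.equivFinOfCardEq rfl).symm
  set N := I.biUnion (nbrOn G univ) with hN
  -- `I` will be sent onto `X`, so the neighbours `N` of `I` must land in `D`, whose vertices are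
  -- red to all of `X`.
  set D := (A \ X) \ X.biUnion (nbrOn Rᶜ A) with hD
  have hNc : #N ≤ #I * 2 :=
    card_biUnion_le_card_mul _ _ _ fun v hv => (mem_filter.1 (hI hv)).2
  have hDc : #N ≤ #D := by
    have h1 := le_card_sdiff (X.biUnion (nbrOn Rᶜ A)) (A \ X)
    have h2 := le_card_sdiff X A
    rw [← hD] at h1
    have h3 : #(X.biUnion (nbrOn Rᶜ A)) ≤ #X * d := card_biUnion_le_card_mul _ _ _ hd
    omega
  -- Hall's condition: a set inside `N` has at most `2 * #X ≤ #D` elements, and any other set has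
  -- all of `A \ X` available.
  obtain ⟨g, hg, hgC⟩ := (all_card_le_biUnion_card_iff_exists_injective
    (fun v : {v // v ∉ I} => if (v : V) ∈ N then D else A \ X)).1 (fun s => by
      by_cases hs : ∀ v ∈ s, (v : V) ∈ N
      · rcases s.eq_empty_or_nonempty with rfl | ⟨v, hv⟩
        · simp
        refine le_trans ?_ (card_le_card (subset_biUnion_of_mem
          (fun v : {v // v ∉ I} => if (v : V) ∈ N then D else A \ X) hv))
        simp only [hs v hv, if_true]
        refine le_trans ?_ hDc
        rw [← card_map (Function.Embedding.subtype (· ∉ I))]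
        refine card_le_card fun w hw => ?_
        obtain ⟨z, hz, rfl⟩ := mem_map.1 hw
        exact hs z hz
      · push Not at hs
        obtain ⟨v, hv, hvN⟩ := hs
        refine le_trans ?_ (card_le_card (subset_biUnion_of_mem
          (fun v : {v // v ∉ I} => if (v : V) ∈ N then D else A \ X) hv))
        simp only [hvN, if_false]
        rw [card_sdiff_of_subset hXA]
        refine (card_le_univ s).trans ?_
        rw [Fintype.card_subtype_compl, Fintype.card_coe]
        omega)
  have hgD : ∀ v : {v // v ∉ I}, (v : V) ∈ N → g v ∈ D := fun v hv => by
    simpa [hv] using hgC v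
  have hgA : ∀ v : {v // v ∉ I}, g v ∈ A \ X := fun v => by
    by_cases hv : (v : V) ∈ N
    · exact (mem_sdiff.1 (hgD v hv)).1
    · simpa [hv] using hgC v
  have key : ∀ u (hu : u ∈ I) v (hv : v ∉ I), G.Adj u v → R.Adj (φ ⟨u, hu⟩) (g ⟨v, hv⟩) := by
    intro u hu v hv huv
    have hvD := hgD ⟨v, hv⟩ (mem_biUnion.2 ⟨u, hu, mem_nbrOn.2 ⟨mem_univ _, huv⟩⟩)
    have hvA := mem_sdiff.1 (hgA ⟨v, hv⟩)
    by_contra hR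
    refine (mem_sdiff.1 hvD).2 (mem_biUnion.2 ⟨φ ⟨u, hu⟩, (φ ⟨u, hu⟩).2, mem_nbrOn.2 ⟨hvA.1, ?_⟩⟩)
    rw [SimpleGraph.compl_adj]
    exact ⟨fun e => hvA.2 (e ▸ (φ ⟨u, hu⟩).2), hR⟩
  refine ⟨fun v => if hv : v ∈ I then φ ⟨v, hv⟩ else g ⟨v, hv⟩, ?_, ?_, ?_⟩
  · intro u _ v _ e
    split_ifs at e with hu hv hv
    · simpa using φ.injective (Subtype.ext e)
    · exact absurd (e ▸ (φ ⟨u, hu⟩).2) (mem_sdiff.1 (hgA ⟨v, hv⟩)).2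
    · exact absurd (e ▸ (φ ⟨v, hv⟩).2) (mem_sdiff.1 (hgA ⟨u, hu⟩)).2
    · simpa using hg e
  · intro v _
    split_ifs with hv
    · exact hXA (φ ⟨v, hv⟩).2
    · exact (mem_sdiff.1 (hgA ⟨v, hv⟩)).1
  · intro u _ v _ e
    split_ifs with hu hv hv
    · exact absurd e (hind u hu v hv)
    · exact key u hu v hv e
    · exact (key v hv u hu e.symm).symm
    · have h1 := mem_sdiff.1 (hgA ⟨u, hu⟩)
      have h2 := mem_sdiff.1 (hgA ⟨v, hv⟩)
      by_contra hR
      rcases hcov _ h1.1 _ h2.1 (by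
        rw [SimpleGraph.compl_adj]
        exact ⟨fun h => e.ne (by simpa using hg h), hR⟩) with h | h
      · exact h1.2 h
      · exact h2.2 h

/-- Sum the inequality `3 ≤ deg + 2·[deg ≤ 2]`, valid since all degrees are positive. -/
theorem ConnOn.card_low_degree [Fintype V] {G : SimpleGraph V} (hG : ConnOn G univ) {l : ℕ}
    (hl : degSum G univ ≤ 2 * (Fintype.card V + l)) (h2 : 2 ≤ Fintype.card V) :
    Fintype.card V ≤ 2 * #{v | degOn G univ v ≤ 2} + 2 * l := by
  have h : ∑ v : V, 3 ≤ ∑ v : V, (degOn G univ v + if degOn G univ v ≤ 2 then 2 else 0) := by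
    refine sum_le_sum fun v hv => ?_
    have := hG.one_le_degOn (by simpa using h2) hv
    split_ifs <;> omega
  rw [sum_add_distrib, ← sum_filter, sum_const, sum_const, smul_eq_mul, smul_eq_mul,
    card_univ] at h
  unfold degSum at hl
  omega

/-- If `t` vertices had blue degree at least `2t`, they could be matched greedily. Discard the at
most `t - 1` such vertices. At least `n` remain, and their blue edges are covered by at most `2(t -
1)` vertices of small blue degree. -/
theorem exists_embOn_of_no_matching [Fintype V] {G : SimpleGraph V} {R : SimpleGraph W}
    {A : Finset W} {t : ℕ} (ht : 1 ≤ t) (hM : ¬ HasMatching Rᶜ A t)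
    (hn : Fintype.card V + t ≤ #A + 1) (hlow : 6 * t ≤ #{v | degOn G univ v ≤ 2})
    (hsize : 6 * t + 4 * (t * t) ≤ Fintype.card V) : ∃ f, EmbOn G R univ A f := by
  set T := A.filter fun h => 2 * t ≤ degOn Rᶜ A h with hT
  have hTc : #T < t := by
    by_contra hc
    obtain ⟨T', hT', hT'c⟩ := exists_subset_card_eq (not_lt.1 hc)
    have hTA : ∀ h ∈ T', h ∈ A ∧ 2 * t ≤ degOn Rᶜ A h := fun h hh => mem_filter.1 (hT' hh)
    obtain ⟨x, y, hxy, hinj⟩ := hasMatching_of_forall_le (B := Rᶜ) (A := A) hT'c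
      (C := nbrOn Rᶜ A) (fun _ _ => Subset.rfl) (fun h hh => (hTA h hh).2)
    exact hM ⟨x, y, fun i => ⟨(hTA _ (hxy i).1).1, nbrOn_subset _ _ _ (hxy i).2.1,
      (hxy i).2.2⟩, hinj⟩
  have hTA : T ⊆ A := filter_subset _ _
  have hc : #(A \ T) = #A - #T := card_sdiff_of_subset hTA
  rcases exists_cover_of_no_matching Rᶜ (A \ T) t with h | ⟨C, hC, hCc, hcov⟩
  · exact absurd (h.mono sdiff_subset) hM
  have hCd : #C * (2 * t) ≤ 4 * (t * t) := by
    calc #C * (2 * t) ≤ (2 * t) * (2 * t) := Nat.mul_le_mul_right _ (by omega)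
      _ = _ := by ring
  obtain ⟨f, hf⟩ := exists_embOn_of_cover (G := G) (R := R) (d := 2 * t) hC hcov (fun x hx => by
      have hx' := mem_sdiff.1 (hC hx)
      have h1 := degOn_mono Rᶜ (sdiff_subset : A \ T ⊆ A) x
      have h2 : ¬ 2 * t ≤ degOn Rᶜ A x := fun h => hx'.2 (mem_filter.2 ⟨hx'.1, h⟩)
      omega) (by omega) (by omega) (by omega)
  exact ⟨f, hf.mono Subset.rfl sdiff_subset⟩

end Finishing

/-! ### Extending an embedding by leaves or along a long path. -/

section Leaves

variable {V W : Type*}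

/-- If a red copy of `G` minus some leaves does not extend, then Hall's condition fails: many
vertices outside are blue to the images of the parents of some of the leaves. -/
theorem exists_deficient_leaves [Fintype V] [Fintype W] {G : SimpleGraph V} {R : SimpleGraph W}
    {L : Finset V} {par : V → V} (hpar : ∀ v ∈ L, par v ∉ L)
    (hleaf : ∀ v ∈ L, ∀ u, G.Adj v u → u = par v) {f : V → W} (hf : EmbOn G R Lᶜ univ f)
    (hno : ¬ G ⊑ R) : ∃ X ⊆ L, X.Nonempty ∧ ∃ A : Finset W,
      (∀ v ∈ X, ∀ a ∈ A, Rᶜ.Adj (f (par v)) a) ∧ (∀ v ∉ L, f v ∉ A) ∧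
      Fintype.card W + 1 + #L ≤ #A + #X + Fintype.card V := by
  set O := (Lᶜ.image f)ᶜ with hO
  have hOmem : ∀ v ∉ L, f v ∉ O := fun v hv h =>
    mem_compl.1 h (mem_image_of_mem f (mem_compl.2 hv))
  by_cases hall : ∀ s : Finset L, #s ≤ #(s.biUnion fun v => nbrOn R O (f (par v)))
  · exfalso
    obtain ⟨g, hg, hgO⟩ := (all_card_le_biUnion_card_iff_exists_injective
      (fun v : L => nbrOn R O (f (par v)))).1 hall
    have hgO' : ∀ v : L, g v ∈ O ∧ R.Adj (f (par v)) (g v) := fun v => mem_nbrOn.1 (hgO v)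
    refine hno (EmbOn.isContained (U := univ)
      (f := fun v => if h : v ∈ L then g ⟨v, h⟩ else f v) ⟨?_, fun _ _ => mem_univ _, ?_⟩)
    · intro u _ v _ e
      split_ifs at e with hu hv hv
      · simpa using hg e
      · exact absurd (e ▸ (hgO' ⟨u, hu⟩).1) (hOmem v hv)
      · exact absurd (e ▸ (hgO' ⟨v, hv⟩).1) (hOmem u hu)
      · exact hf.inj u (mem_compl.2 hu) v (mem_compl.2 hv) e
    · intro u _ v _ e
      split_ifs with hu hv hv
      · exact absurd (hleaf u hu v e ▸ hv) (hpar u hu)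
      · rw [hleaf u hu v e]; exact (hgO' ⟨u, hu⟩).2.symm
      · rw [hleaf v hv u e.symm]; exact (hgO' ⟨v, hv⟩).2
      · exact hf.adj u (mem_compl.2 hu) v (mem_compl.2 hv) e
  · push Not at hall
    obtain ⟨s, hs⟩ := hall
    set D := s.biUnion fun v => nbrOn R O (f (par v)) with hD
    refine ⟨s.map (Function.Embedding.subtype (· ∈ L)), ?_, ?_, O \ D, ?_, ?_, ?_⟩
    · intro v hv
      obtain ⟨z, -, rfl⟩ := mem_map.1 hv
      exact z.2
    · rw [map_nonempty]
      exact card_pos.1 (by omega)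
    · intro v hv a ha
      obtain ⟨z, hz, rfl⟩ := mem_map.1 hv
      rw [mem_sdiff] at ha
      rw [SimpleGraph.compl_adj]
      refine ⟨?_, fun h => ha.2 (mem_biUnion.2 ⟨z, hz, mem_nbrOn.2 ⟨ha.1, h⟩⟩)⟩
      rintro rfl
      exact hOmem _ (hpar z z.2) ha.1
    · exact fun v hv h => hOmem v hv (mem_sdiff.1 h).1
    · have h1 := le_card_sdiff D O
      have h2 : #(Lᶜ.image f)ᶜ + #(Lᶜ.image f) = Fintype.card W := card_compl_add_card _
      have h3 : #Lᶜ + #L = Fintype.card V := card_compl_add_card _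
      rw [hf.card_image, ← hO] at h2
      rw [card_map]
      omega

/-- Contract until `hweak` applies, then undo the contractions. Before each lengthening at most `n -
1` vertices are used, so at least `n + t - 1` lie outside, exactly the threshold of `hmatch`. -/
theorem exists_embOn_of_long_path {n t k l : ℕ} [Fintype W] {R : SimpleGraph W}
    (hN : Fintype.card W + 2 = 2 * n + t) (hbook : ¬ copies t (book k) ⊑ Rᶜ)
    (hmatch : ∀ A : Finset W, n + t ≤ #A + 1 → HasMatching Rᶜ A t)
    (hweak : ∀ (H : SimpleGraph V) (S : Finset V), ConnOn H S → degSum H S ≤ 2 * (#S + l) →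
      #S + t * k ≤ n → ∃ f, EmbOn H R S univ f) (j : ℕ) :
    ∀ (H : SimpleGraph V) (S : Finset V) (p : ℕ → V), #S + t * k = n + j → j ≤ t * k →
      ConnOn H S → degSum H S ≤ 2 * (#S + l) → SuspOn H S p (3 * (t * k) + 4 * t + j) →
      ∃ f, EmbOn H R S univ f := by
  induction j with
  | zero => exact fun H S p hc _ hS hd _ => hweak H S hS hd hc.le
  | succ j ih =>
    intro H S p hc hj hS hd hp
    have hp : SuspOn H S p ((3 * (t * k) + 4 * t + j) + 1) := hp
    have hcard : #(S.erase (p 1)) + 1 = #S := card_erase_add_one (hp.mem 1 (by omega))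
    obtain ⟨f, hf⟩ := ih _ (S.erase (p 1)) (shortcut p) (by omega) (by omega)
      (hp.connOn_shortcut hS) (hp.degSum_shortcut hd) hp.shortcut
    have hAc : #((S.erase (p 1)).image f)ᶜ + #(S.erase (p 1)) = Fintype.card W := by
      rw [← hf.card_image]; exact card_compl_add_card _
    exact hp.exists_embOn_of_shortcut hf (by omega) hbook (hmatch _ (by omega))

end Leaves

/-! ### Blue graphs that are nearly complete bipartite. -/

section Bipartition

variable {V W : Type*}

theorem le_card_nbrOn_inter (B : SimpleGraph W) (U : Finset W) (x y : W) :
    degOn B U x + degOn B U y ≤ #(nbrOn B U x ∩ nbrOn B U y) + #U := by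
  have h1 := card_union_add_card_inter (nbrOn B U x) (nbrOn B U y)
  have h2 := card_le_card (union_subset (nbrOn_subset B U x) (nbrOn_subset B U y))
  unfold degOn
  omega

theorem copies_book_isContained_of_inter {B : SimpleGraph W} {U : Finset W} {t k : ℕ}
    {x y : Fin t → W} (hxy : ∀ i, B.Adj (x i) (y i)) (hinj : Function.Injective (Sum.elim x y))
    (hU : ∀ i, x i ∉ U ∧ y i ∉ U)
    (hc : ∀ i, t * k + #U ≤ degOn B U (x i) + degOn B U (y i)) : copies t (book k) ⊑ B := by
  refine copies_book_isContained hxy hinj (fun i => nbrOn B U (x i) ∩ nbrOn B U (y i))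
    (fun i => ?_) (fun i w hw => ?_) (fun i w hw j => ?_)
  · have := le_card_nbrOn_inter B U (x i) (y i)
    have := hc i
    omega
  · simp only [mem_inter, mem_nbrOn] at hw
    exact ⟨hw.1.2, hw.2.2⟩
  · simp only [mem_inter, mem_nbrOn] at hw
    exact ⟨fun e => (hU j).1 (e ▸ hw.1.1), fun e => (hU j).2 (e ▸ hw.1.1)⟩

/-- `t` disjoint blue edges in `A` would find their pages in `B`. So a small set `C` covers the blue
edges in `A`, and `C ∪ Y` covers those in `A ∪ Y` with bounded blue degrees. -/
theorem isContained_of_side [Fintype V] {G : SimpleGraph V} {R : SimpleGraph W} {t k m T d : ℕ}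
    {A B Y : Finset W} (hAB : Disjoint A B) (hAm : ∀ a ∈ A, #B ≤ degOn Rᶜ B a + m)
    (hAd : ∀ a ∈ A, degOn Rᶜ A a ≤ d) (hdT : d ≤ T) (hB : t * k + 2 * m ≤ #B)
    (hbook : ¬ copies t (book k) ⊑ Rᶜ) (hY : ∀ y ∈ Y, degOn Rᶜ A y ≤ T)
    (hn : Fintype.card V ≤ #(A ∪ Y))
    (hlow : 3 * (#Y + 2 * t) ≤ #{v | degOn G univ v ≤ 2})
    (hsize : (#Y + 2 * t) * (T + #Y + 3) ≤ Fintype.card V) : G ⊑ R := by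
  have hM : ¬ HasMatching Rᶜ A t := by
    rintro ⟨x, y, hxy, hinj⟩
    refine hbook (copies_book_isContained_of_inter (U := B) (fun i => (hxy i).2.2) hinj
      (fun i => ⟨disjoint_left.1 hAB (hxy i).1, disjoint_left.1 hAB (hxy i).2.1⟩) fun i => ?_)
    have := hAm _ (hxy i).1
    have := hAm _ (hxy i).2.1
    omega
  obtain ⟨C, hC, hCc, hcov⟩ := (exists_cover_of_no_matching Rᶜ A t).resolve_left hM
  have hXc : #(C ∪ Y) ≤ #Y + 2 * t := (card_union_le _ _).trans (by omega)
  have hmul : 3 * #(C ∪ Y) + #(C ∪ Y) * (T + #Y) ≤ (#Y + 2 * t) * (T + #Y + 3) := by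
    calc 3 * #(C ∪ Y) + #(C ∪ Y) * (T + #Y) = #(C ∪ Y) * (T + #Y + 3) := by ring
      _ ≤ _ := Nat.mul_le_mul_right _ hXc
  have hcovY : ∀ a ∈ A ∪ Y, ∀ b ∈ A ∪ Y, Rᶜ.Adj a b → a ∈ C ∪ Y ∨ b ∈ C ∪ Y := by
    intro a ha b hb hab
    simp only [mem_union] at ha hb ⊢
    rcases ha with ha | ha
    · rcases hb with hb | hb
      · have := hcov a ha b hb hab
        tauto
      · tauto
    · tauto
  have hdeg : ∀ x ∈ C ∪ Y, degOn Rᶜ (A ∪ Y) x ≤ T + #Y := by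
    intro x hx
    have h1 : degOn Rᶜ (A ∪ Y) x ≤ degOn Rᶜ A x + #Y := by
      have : nbrOn Rᶜ (A ∪ Y) x ⊆ nbrOn Rᶜ A x ∪ Y := by
        intro w hw
        simp only [mem_union, mem_nbrOn] at hw ⊢
        tauto
      exact (card_le_card this).trans (card_union_le _ _)
    rcases mem_union.1 hx with h | h
    · have := hAd x (hC h)
      omega
    · have := hY x h
      omega
  obtain ⟨f, hf⟩ := exists_embOn_of_cover (G := G) (union_subset_union_left hC) hcovY hdeg hn
    (by omega) (by omega)
  exact hf.isContained

/-- If the blue graph is nearly complete bipartite, then there is a red `G` or a blue `t B_k`. -/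
theorem isContained_of_bipartition [Fintype V] [Fintype W] {G : SimpleGraph V} {R : SimpleGraph W}
    {t k m d : ℕ} {A B Y : Finset W} (ht : 1 ≤ t)
    (hN : Fintype.card W + 2 = 2 * Fintype.card V + t)
    (hAB : Disjoint A B) (hY : Y = (A ∪ B)ᶜ)
    (hAm : ∀ a ∈ A, #B ≤ degOn Rᶜ B a + m) (hBm : ∀ b ∈ B, #A ≤ degOn Rᶜ A b + m)
    (hAd : ∀ a ∈ A, degOn Rᶜ A a ≤ d) (hBd : ∀ b ∈ B, degOn Rᶜ B b ≤ d)
    (hdm : d ≤ m + 2 * t + t * k) (hA : t * k + 2 * m ≤ #A) (hB : t * k + 2 * m ≤ #B)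
    (hbook : ¬ copies t (book k) ⊑ Rᶜ)
    (hlow : 3 * (#Y + 2 * t) ≤ #{v | degOn G univ v ≤ 2})
    (hsize : (#Y + 2 * t) * (m + 2 * t + t * k + #Y + 3) ≤ Fintype.card V) : G ⊑ R := by
  set T := m + 2 * t + t * k with hT
  have hYA : ∀ y ∈ Y, y ∉ A ∧ y ∉ B := fun y hy => by
    rw [hY, mem_compl, mem_union, not_or] at hy; exact hy
  -- Vertices of `Q` have many blue neighbours on both sides. If there were `t` of them, matching
  -- them into `A` and taking pages in `B` would give `t` books.
  set Q := Y.filter fun y => T ≤ degOn Rᶜ A y ∧ T ≤ degOn Rᶜ B y with hQ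
  have hQc : #Q < t := by
    by_contra hc
    obtain ⟨Q', hQ', hQ'c⟩ := exists_subset_card_eq (not_lt.1 hc)
    have hm : ∀ y ∈ Q', y ∈ Y ∧ T ≤ degOn Rᶜ A y ∧ T ≤ degOn Rᶜ B y := fun y hy =>
      mem_filter.1 (hQ' hy)
    obtain ⟨x, y, hxy, hinj⟩ := hasMatching_of_forall_le (B := Rᶜ) (A := A) hQ'c
      (C := nbrOn Rᶜ A) (fun _ _ => Subset.rfl) (fun h hh => by
        have := (hm h hh).2.1
        unfold degOn at this
        omega)
    have hyA : ∀ i, y i ∈ A := fun i => nbrOn_subset _ _ _ (hxy i).2.1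
    refine hbook (copies_book_isContained_of_inter (U := B) (fun i => (hxy i).2.2) hinj
      (fun i => ⟨(hYA _ (hm _ (hxy i).1).1).2, disjoint_left.1 hAB (hyA i)⟩) fun i => ?_)
    have := (hm _ (hxy i).1).2.2
    have := hAm _ (hyA i)
    omega
  set YA := (Y \ Q).filter fun y => degOn Rᶜ A y ≤ T with hYAdef
  set YB := (Y \ Q) \ YA with hYBdef
  have hYAs : YA ⊆ Y := (filter_subset _ _).trans sdiff_subset
  have hYBs : YB ⊆ Y := sdiff_subset.trans sdiff_subset
  have hYAc := card_le_card hYAs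
  have hYBc := card_le_card hYBs
  have hsum : #YB + #YA = #(Y \ Q) := card_sdiff_add_card_eq_card (filter_subset _ _)
  have hYQ : #(Y \ Q) + #Q = #Y := card_sdiff_add_card_eq_card (filter_subset _ _)
  have hYN : #Y + (#A + #B) = Fintype.card W := by
    rw [hY, ← card_union_of_disjoint hAB]; exact card_compl_add_card _
  have hA1 : #(A ∪ YA) = #A + #YA := card_union_of_disjoint
    (disjoint_right.2 fun y hy => (hYA y (hYAs hy)).1)
  have hB1 : #(B ∪ YB) = #B + #YB := card_union_of_disjoint
    (disjoint_right.2 fun y hy => (hYA y (hYBs hy)).2)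
  have hsz : ∀ Y' : Finset W, #Y' ≤ #Y →
      (#Y' + 2 * t) * (T + #Y' + 3) ≤ Fintype.card V := fun Y' h =>
    (Nat.mul_le_mul (by omega) (by omega)).trans hsize
  -- At most `t - 1` vertices are lost to `Q`, so the enlarged sides have together at least `N - (t
  -- - 1) = 2n - 1` vertices and one of them has `n`.
  by_cases hcase : Fintype.card V ≤ #(A ∪ YA)
  · exact isContained_of_side hAB hAm hAd hdm hB hbook (Y := YA)
      (fun y hy => (mem_filter.1 hy).2) hcase (by omega) (hsz _ hYAc)
  · refine isContained_of_side hAB.symm hBm hBd hdm hA hbook (Y := YB) (fun y hy => ?_) (by omega)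
      (by omega) (hsz _ hYBc)
    have h := mem_sdiff.1 hy
    have h1 := mem_sdiff.1 h.1
    have h2 : ¬ degOn Rᶜ A y ≤ T := fun h2 => h.2 (mem_filter.2 ⟨h.1, h2⟩)
    by_contra hlt
    exact h1.2 (mem_filter.2 ⟨h1.1, by omega, by omega⟩)

end Bipartition

/-! ### The upper bound: many leaves against a long suspended path. -/

section UpperBound

variable {V W : Type*}

theorem pred_mul_add_two {t k : ℕ} (ht : 1 ≤ t) : (t - 1) * (k + 2) + k + 2 = t * k + 2 * t := by
  obtain ⟨s, rfl⟩ : ∃ s, t = s + 1 := ⟨t - 1, by omega⟩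
  rw [Nat.add_sub_cancel]; ring

theorem add_le_mul_add_one {t k : ℕ} (ht : 1 ≤ t) (hk : 1 ≤ k) : t + k ≤ t * k + 1 := by
  obtain ⟨s, rfl⟩ : ∃ s, t = s + 1 := ⟨t - 1, by omega⟩
  obtain ⟨r, rfl⟩ : ∃ r, k = r + 1 := ⟨k - 1, by omega⟩
  have : (s + 1) * (r + 1) = s * r + s + r + 1 := by ring
  omega

/-- The case of a vertex with many leaves. -/
theorem isContained_of_many_leaves_at_vertex [Fintype V] [Fintype W] {G : SimpleGraph V}
    {R : SimpleGraph W} {t k l : ℕ} (ht : 1 ≤ t) (hk : 1 ≤ k)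
    (hN : Fintype.card W + 2 = 2 * Fintype.card V + t) (hS : Sparse G univ l)
    (hlow : 21 * (t * k) ≤ #{v | degOn G univ v ≤ 2})
    (hP : 77 * (t * k * (t * k)) ≤ Fintype.card V)
    (hl : 2 * l + 3 + (k - 1) * (2 * l + 2) + 3 * (t * k) ≤ Fintype.card V)
    (hbook : ¬ copies t (book k) ⊑ Rᶜ)
    {Z : Finset W} (hZ : #Z ≤ (t - 1) * (k + 2)) (hfree : BookFreeOn R Zᶜ k)
    {p : V} {L : Finset V} (hpL : p ∉ L) (hL : ∀ v ∈ L, ∀ u, G.Adj v u → u = p)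
    (hLc : 2 * (t * k) ≤ #L + 1) (hweak : ∃ f, EmbOn G R Lᶜ Zᶜ f) : G ⊑ R := by
  by_contra hno
  have hz := pred_mul_add_two (k := k) ht
  have htk := add_le_mul_add_one ht hk
  have htP : t ≤ t * k := Nat.le_mul_of_pos_right _ (by omega)
  have hkP : k ≤ t * k := Nat.le_mul_of_pos_left _ (by omega)
  have hPP : t * k ≤ t * k * (t * k) := Nat.le_mul_of_pos_left _ (by omega)
  generalize hPdef : t * k = P at *
  generalize (t - 1) * (k + 2) = z at *
  have hZc : #Zᶜ + #Z = Fintype.card W := card_compl_add_card _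
  have hLcc : #Lᶜ + #L = Fintype.card V := card_compl_add_card _
  -- In the deficiency bound `#X ≤ #L`, so the set blue to the image of `p` has at least `N + 1 - n
  -- = n + t - 1` vertices.
  have root : ∀ f, EmbOn G R Lᶜ univ f →
      Fintype.card V + t ≤ degOn Rᶜ univ (f p) + 1 := by
    intro f hf
    obtain ⟨X, hXL, ⟨v, hv⟩, A, hA, -, hAc⟩ := exists_deficient_leaves (par := fun _ => p)
      (fun _ _ => hpL) hL hf hno
    have h1 : #A ≤ degOn Rᶜ univ (f p) := card_le_card fun a ha =>
      mem_nbrOn.2 ⟨mem_univ _, hA v hv a ha⟩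
    have h2 := card_le_card hXL
    omega
  have inU : ∀ x, degOn Rᶜ univ x ≤ degOn Rᶜ Zᶜ x + #Z := by
    intro x
    have : nbrOn Rᶜ univ x ⊆ nbrOn Rᶜ Zᶜ x ∪ Z := by
      intro w hw
      simp only [mem_union, mem_nbrOn, mem_compl, mem_univ, true_and] at hw ⊢
      tauto
    exact (card_le_card this).trans (card_union_le _ _)
  have nbhd : ∀ x ∈ Zᶜ, ∀ a ∈ nbrOn Rᶜ Zᶜ x, degOn Rᶜ (nbrOn Rᶜ Zᶜ x) a ≤ k - 1 :=
    fun x hx => hfree.degOn_le hx (nbrOn_subset _ _ _) fun a ha => (mem_nbrOn.1 ha).2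
  -- The blue neighbourhood of `x` is nearly red. Since omitting `L` makes enough room, `G` without
  -- `L` embeds in it with `p` at any chosen `a`, and `root` passes the large blue degree on to `a`.
  have step : ∀ x ∈ Zᶜ, Fintype.card V + t ≤ degOn Rᶜ univ x + 1 →
      ∀ a ∈ nbrOn Rᶜ Zᶜ x, Fintype.card V + t ≤ degOn Rᶜ univ a + 1 := by
    intro x hx hxd a ha
    have h1 := inU x
    have h2 : degOn Rᶜ Zᶜ x = #(nbrOn Rᶜ Zᶜ x) := rfl
    have hS' : Sparse G Lᶜ l := fun T _ => hS T (subset_univ _)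
    obtain ⟨f, hf, rfl⟩ := hS'.exists_embOn_rooted (nbhd x hx) (by omega) (by omega)
      (mem_compl.2 hpL) ha
    exact root f (hf.mono Subset.rfl (subset_univ _))
  obtain ⟨f, hf⟩ := hweak
  have hx0 := hf.mem p (mem_compl.2 hpL)
  have hx0d := root f (hf.mono Subset.rfl (subset_univ _))
  generalize f p = x at hx0 hx0d
  set A := nbrOn Rᶜ Zᶜ x with hA
  have hAc : Fintype.card V + t ≤ #A + z + 1 := by
    have h1 := inU x
    have h2 : degOn Rᶜ Zᶜ x = #A := rfl
    omega
  have hAdeg := step x hx0 hx0d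
  have hAd : ∀ a ∈ A, degOn Rᶜ A a ≤ k - 1 := nbhd x hx0
  -- The two sides are the blue neighbourhoods of `x` and of a blue neighbour `y` of `x`, which
  -- overlap in at most `k - 1` vertices.
  obtain ⟨y, hy⟩ : A.Nonempty := card_pos.1 (by omega)
  have hyZ : y ∈ Zᶜ := nbrOn_subset _ _ _ hy
  set B' := nbrOn Rᶜ Zᶜ y with hB'
  set B := B' \ A with hB
  have hBs : B ⊆ B' := sdiff_subset
  have hBc : Fintype.card V + t ≤ #B + (k - 1) + z + 1 := by
    have h1 := inU y
    have h2 : degOn Rᶜ Zᶜ y = #B' := rfl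
    have h3 := hAdeg y hy
    have h4 := hAd y hy
    have h5 : #B' ≤ #B + degOn Rᶜ A y := by
      have : B' ⊆ B ∪ nbrOn Rᶜ A y := by
        intro w hw
        by_cases hwA : w ∈ A
        · exact mem_union_right _ (mem_nbrOn.2 ⟨hwA, (mem_nbrOn.1 hw).2⟩)
        · exact mem_union_left _ (mem_sdiff.2 ⟨hw, hwA⟩)
      exact (card_le_card this).trans (card_union_le _ _)
    omega
  have hBdeg : ∀ b ∈ B, Fintype.card V + t ≤ degOn Rᶜ univ b + 1 := fun b hb =>
    step y hyZ (hAdeg y hy) b (hBs hb)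
  have hBd : ∀ b ∈ B, degOn Rᶜ B b ≤ k - 1 := fun b hb =>
    (degOn_mono _ hBs b).trans (nbhd y hyZ b (hBs hb))
  have hAB : Disjoint A B := disjoint_sdiff
  have hYN : #(A ∪ B)ᶜ + (#A + #B) = Fintype.card W := by
    rw [← card_union_of_disjoint hAB]; exact card_compl_add_card _
  have hsplit : ∀ w, degOn Rᶜ univ w ≤ degOn Rᶜ A w + degOn Rᶜ B w + #(A ∪ B)ᶜ := by
    intro w
    have : nbrOn Rᶜ univ w ⊆ nbrOn Rᶜ A w ∪ nbrOn Rᶜ B w ∪ (A ∪ B)ᶜ := by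
      intro u hu
      simp only [mem_union, mem_nbrOn, mem_compl, mem_univ, true_and] at hu ⊢
      tauto
    exact (card_le_card this).trans ((card_union_le _ _).trans
      (Nat.add_le_add_right (card_union_le _ _) _))
  refine hno (isContained_of_bipartition (k := k) (m := z + 2 * k) (d := k - 1) ht hN hAB rfl
    (fun a ha => ?_) (fun b hb => ?_) hAd hBd (by omega) (by omega) (by omega) hbook
    (by omega) ?_)
  · have h1 := hsplit a
    have h2 := hAdeg a ha
    have h3 := hAd a ha
    omega
  · have h1 := hsplit b
    have h2 := hBdeg b hb
    have h3 := hBd b hb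
    omega
  · calc _ ≤ (7 * P) * (11 * P) := Nat.mul_le_mul (by omega) (by omega)
      _ = 77 * (P * P) := by ring
      _ ≤ _ := hP

/-- The case of many leaves, few of them with a common neighbour. -/
theorem isContained_of_many_leaves [Fintype V] [Fintype W] {G : SimpleGraph V}
    {R : SimpleGraph W} {t k l : ℕ} (ht : 1 ≤ t) (hk : 1 ≤ k)
    (hN : Fintype.card W + 2 = 2 * Fintype.card V + t) (hS : Sparse G univ l)
    (hl : 2 * l + 3 + (k - 1) * (2 * l + 2) ≤ Fintype.card V)
    (hbook : ¬ copies t (book k) ⊑ Rᶜ)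
    (hmatch : ∀ A : Finset W, Fintype.card V + t ≤ #A + 1 → HasMatching Rᶜ A t)
    {Z : Finset W} (hZ : #Z ≤ (t - 1) * (k + 2)) (hfree : BookFreeOn R Zᶜ k)
    {L : Finset V} {par : V → V} (hpar : ∀ v ∈ L, par v ∉ L)
    (hL : ∀ v ∈ L, ∀ u, G.Adj v u → u = par v)
    (hfew : ∀ p, #{v ∈ L | par v = p} ≤ 2 * (t * k) - 2)
    (hLc : 2 * (t * k * (t * k)) ≤ #L) (hweak : ∃ f, EmbOn G R Lᶜ Zᶜ f) : G ⊑ R := by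
  by_contra hno
  have hz := pred_mul_add_two (k := k) ht
  have htk := add_le_mul_add_one ht hk
  obtain ⟨f, hf⟩ := hweak
  obtain ⟨X, hXL, ⟨v, hv⟩, A, hA, hout, hAc⟩ := exists_deficient_leaves hpar hL
    (hf.mono Subset.rfl (subset_univ _)) hno
  have hXLc := card_le_card hXL
  have hparL : ∀ u ∈ X.image par, u ∉ L := fun u hu => by
    obtain ⟨w, hw, rfl⟩ := mem_image.1 hu
    exact hpar w (hXL hw)
  have hXc : #X ≤ (2 * (t * k) - 2) * #(X.image par) :=
    card_le_mul_card_image X _ fun p _ => (card_le_card (filter_subset_filter _ hXL)).trans (hfew p)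
  -- With `tk` parents, their images are common pages for `t` disjoint blue edges in `A`, which has
  -- at least `n + t - 1` vertices.
  by_cases hcase : t * k ≤ #(X.image par)
  · obtain ⟨x, y, hxy, hinj⟩ := hmatch A (by omega)
    refine hbook (copies_book_isContained (fun i => (hxy i).2.2) hinj
      (fun _ => (X.image par).image f) (fun _ => ?_) (fun i w hw => ?_) fun i w hw j => ?_)
    · rw [card_image_of_injOn]
      · exact hcase
      · exact fun a ha b hb e => hf.inj a (mem_compl.2 (hparL a ha)) b (mem_compl.2 (hparL b hb)) e
    · obtain ⟨u, hu, rfl⟩ := mem_image.1 hw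
      obtain ⟨v, hv, rfl⟩ := mem_image.1 hu
      exact ⟨(hA v hv _ (hxy i).1).symm, (hA v hv _ (hxy i).2.1).symm⟩
    · obtain ⟨u, hu, rfl⟩ := mem_image.1 hw
      have := hout u (hparL u hu)
      exact ⟨fun e => this (e ▸ (hxy j).1), fun e => this (e ▸ (hxy j).2.1)⟩
  -- With fewer parents, `#X ≤ 2(tk - 1)²` falls short of `#L` by enough to make `A \ Z` hold all of
  -- `G`. As part of one blue neighbourhood it is nearly red.
  · have hXc' : #X + 4 * (t * k) ≤ 2 * (t * k * (t * k)) + 2 := by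
      have h1 : #X ≤ (2 * (t * k) - 2) * (t * k - 1) :=
        hXc.trans (Nat.mul_le_mul_left _ (by omega))
      have h2 : 1 ≤ t * k := Nat.mul_pos ht hk
      generalize t * k = P at *
      obtain ⟨s, rfl⟩ : ∃ s, P = s + 1 := ⟨P - 1, by omega⟩
      have e1 : (2 * (s + 1) - 2) * (s + 1 - 1) = 2 * (s * s) := by
        rw [Nat.add_sub_cancel, show 2 * (s + 1) - 2 = 2 * s by omega]; ring
      have e2 : 2 * ((s + 1) * (s + 1)) = 2 * (s * s) + 4 * s + 2 := by ring
      omega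
    have hpv : par v ∉ L := hpar v (hXL hv)
    have hd := hfree.degOn_le (hf.mem (par v) (mem_compl.2 hpv)) (A := A \ Z)
      (fun a ha => mem_compl.2 (mem_sdiff.1 ha).2) (fun a ha => hA v hv a (mem_sdiff.1 ha).1)
    have h1 := le_card_sdiff Z A
    obtain ⟨g, hg⟩ := hS.exists_embOn hd (by rw [card_univ]; omega) (by omega)
      ⟨v, mem_univ _⟩
    exact hno hg.isContained

/-- The upper bound for the Ramsey number. -/
theorem isContained_or_copies_book [Fintype V] [Fintype W] {G : SimpleGraph V}
    {R : SimpleGraph W} {t k l : ℕ} (ht : 1 ≤ t) (hk : 1 ≤ k)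
    (hN : Fintype.card W + 2 = 2 * Fintype.card V + t) (hG : ConnOn G univ)
    (hdeg : degSum G univ ≤ 2 * (Fintype.card V + l))
    (hn : 111 * (t * k * (t * k) * (t * k)) ≤ Fintype.card V)
    (hl : l * (127 * (t * k * (t * k)) + 79 * (t * (t * k))) ≤ Fintype.card V) :
    G ⊑ R ∨ copies t (book k) ⊑ Rᶜ := by
  by_contra hcon
  rw [not_or] at hcon
  obtain ⟨hno, hbook⟩ := hcon
  have hz := pred_mul_add_two (k := k) ht
  have htk := add_le_mul_add_one ht hk
  have htP : t ≤ t * k := Nat.le_mul_of_pos_right _ (by omega)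
  have hkP : k ≤ t * k := Nat.le_mul_of_pos_left _ (by omega)
  have hPP : t * k ≤ t * k * (t * k) := Nat.le_mul_of_pos_left _ (by omega)
  have hPPP : t * k * (t * k) ≤ t * k * (t * k) * (t * k) := Nat.le_mul_of_pos_right _ (by omega)
  have htt : t * t ≤ t * k * (t * k) := Nat.mul_le_mul htP htP
  have hkl : k * l ≤ t * k * l := Nat.mul_le_mul_right l hkP
  have hlP : l ≤ t * k * l := Nat.le_mul_of_pos_left _ (by omega)
  have htl : t * l ≤ t * k * l := Nat.mul_le_mul_right l htP
  have hl1 : 127 * (t * k * l) + 79 * (t * l) ≤ Fintype.card V := by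
    refine le_trans ?_ hl
    have h1 := Nat.mul_le_mul_left l hPP
    have h2 : t * l ≤ l * (t * (t * k)) := by
      calc t * l = l * (t * 1) := by ring
        _ ≤ _ := Nat.mul_le_mul_left l (Nat.mul_le_mul_left t (by omega))
    calc 127 * (t * k * l) + 79 * (t * l) = 127 * (l * (t * k)) + 79 * (t * l) := by ring
      _ ≤ 127 * (l * (t * k * (t * k))) + 79 * (l * (t * (t * k))) := by omega
      _ = _ := by ring
  have hl2 : l + t * l ≤ t * k * l + t * l := by omega
  have hlt : l ≤ t * l := Nat.le_mul_of_pos_left _ (by omega)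
  have hcardV : 2 ≤ Fintype.card V := by omega
  have hkk : (k - 1) * (2 * l + 2) + 2 * l + 2 = 2 * (k * l) + 2 * k := by
    obtain ⟨r, rfl⟩ : ∃ r, k = r + 1 := ⟨k - 1, by omega⟩
    rw [Nat.add_sub_cancel]; ring
  have hS : Sparse G univ l := hG.sparse (by rwa [card_univ])
  have hlow := hG.card_low_degree hdeg hcardV
  have hmatch : ∀ A : Finset W, Fintype.card V + t ≤ #A + 1 → HasMatching Rᶜ A t := by
    intro A hA
    by_contra hM
    obtain ⟨f, hf⟩ := exists_embOn_of_no_matching (G := G) ht hM hA (by omega) (by omega)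
    exact hno hf.isContained
  obtain ⟨Z, hZ, hfree⟩ := (exists_bookFreeOn R k t).resolve_left hbook
  have hZc : #Zᶜ + #Z = Fintype.card W := card_compl_add_card _
  have hweak : ∀ (H : SimpleGraph V) (S : Finset V), ConnOn H S → degSum H S ≤ 2 * (#S + l) →
      #S + t * k ≤ Fintype.card V → ∃ f, EmbOn H R S Zᶜ f := fun H S hH hd hc =>
    hH.exists_embOn_of_bookFree hk hfree (by omega) hd (by omega)
  set L := univ.filter fun v => degOn G univ v ≤ 1 with hLdef
  have hLmem : ∀ v ∈ L, degOn G univ v ≤ 1 := fun v hv => (mem_filter.1 hv).2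
  by_cases hb : 2 * (t * k * (t * k)) ≤ #L
  · have hone : ∀ v : V, ∃ u, G.Adj v u := fun v => by
      obtain ⟨u, hu⟩ := card_pos.1 (hG.one_le_degOn (by simpa using hcardV) (mem_univ v))
      exact ⟨u, (mem_nbrOn.1 hu).2⟩
    choose par hpar using hone
    have huniq : ∀ v ∈ L, ∀ u w, G.Adj v u → G.Adj v w → u = w := fun v hv u w hu hw =>
      card_le_one.1 (hLmem v hv) u (mem_nbrOn.2 ⟨mem_univ _, hu⟩) w (mem_nbrOn.2 ⟨mem_univ _, hw⟩)
    have hLpar : ∀ v ∈ L, ∀ u ∈ L, ¬ G.Adj v u := by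
      intro v hv u hu hvu
      obtain ⟨a, ha, b, -, hbT, hab⟩ := hG {v, u} (subset_univ _) (insert_nonempty _ _) (by
        intro h
        have h1 := card_le_two (a := v) (b := u)
        rw [h, card_univ] at h1
        omega)
      simp only [mem_insert, mem_singleton, not_or] at ha hbT
      rcases ha with rfl | rfl
      · exact hbT.2 (huniq _ hv _ _ hab hvu)
      · exact hbT.1 (huniq _ hu _ _ hab hvu.symm)
    have hweakL : ∀ L' ⊆ L, t * k ≤ #L' → L'ᶜ.Nonempty → ∃ f, EmbOn G R L'ᶜ Zᶜ f := by
      intro L' hL' hc hne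
      have h1 : #L'ᶜ + #L' = Fintype.card V := card_compl_add_card _
      refine hweak G L'ᶜ ?_ (hS _ (subset_univ _) hne) (by omega)
      rw [compl_eq_univ_sdiff]
      exact hG.sdiff L' (subset_univ _) fun v hv => hLmem v (hL' hv)
    by_cases hstar : ∃ p, 2 * (t * k) ≤ #{v ∈ L | par v = p} + 1
    · obtain ⟨p, hp⟩ := hstar
      set L' := L.filter fun v => par v = p with hL'
      have hL'm : ∀ v ∈ L', v ∈ L ∧ par v = p := fun v hv => mem_filter.1 hv
      obtain ⟨v, hv⟩ : L'.Nonempty := card_pos.1 (by omega)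
      have hpL : p ∉ L := fun h => hLpar v (hL'm v hv).1 p h ((hL'm v hv).2 ▸ hpar v)
      have hpL' : p ∉ L' := fun h => hpL (hL'm p h).1
      exact hno (isContained_of_many_leaves_at_vertex ht hk hN hS (by omega) (by omega) (by omega)
        hbook hZ hfree hpL' (fun v hv u hu => (huniq v (hL'm v hv).1 u _ hu (hpar v)).trans
          (hL'm v hv).2) hp (hweakL L' (filter_subset _ _) (by omega) ⟨p, mem_compl.2 hpL'⟩))
    · push Not at hstar
      obtain ⟨v, hv⟩ : L.Nonempty := card_pos.1 (by omega)
      have hparL : ∀ v ∈ L, par v ∉ L := fun v hv h => hLpar v hv _ h (hpar v)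
      exact hno (isContained_of_many_leaves ht hk hN hS (by omega) hbook hmatch hZ hfree
        (par := par) hparL (fun v hv u hu => huniq v hv u _ hu (hpar v))
        (fun p => by have := hstar p; omega) hb
        (hweakL L Subset.rfl (by omega) ⟨par v, mem_compl.2 (hparL v hv)⟩))
  -- Of the `4tk + 4t` inner vertices, `tk` are to be contracted and `3tk + 4t` are needed for
  -- lengthening. With `4tk + 4t ≤ 8tk` and fewer than `2(tk)²` leaves, the main cost is `64(tk)³`.
  · obtain ⟨p, hp⟩ := hG.exists_suspOn (l := l) (b := 2 * (t * k * (t * k)) - 1)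
      (q := 3 * (t * k) + 4 * t + t * k) (by rwa [card_univ]) (by simpa using hcardV)
      (by change #L ≤ _; omega) (by
        have hb1 : 4 * (2 * (t * k * (t * k)) - 1) + 2 = 8 * (t * k * (t * k)) - 2 := by omega
        have h1 : (3 * (t * k) + 4 * t + t * k) * (4 * (2 * (t * k * (t * k)) - 1) + 2) ≤
            64 * (t * k * (t * k) * (t * k)) - 16 * (t * k) := by
          rw [hb1]
          calc _ ≤ (8 * (t * k)) * (8 * (t * k * (t * k)) - 2) :=
                Nat.mul_le_mul_right _ (by omega)
            _ = _ := by
              rw [Nat.mul_sub]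
              congr 1 <;> ring
        have h2 : (3 * (t * k) + 4 * t + t * k) * (6 * l) = 24 * (t * k * l) + 24 * (t * l) := by
          ring
        rw [card_univ, add_assoc (6 * l), mul_add]
        omega)
    obtain ⟨f, hf⟩ := exists_embOn_of_long_path hN hbook hmatch
      (fun H S hH hd hc => (hweak H S hH hd hc).imp fun f hf => hf.mono Subset.rfl (subset_univ _))
      (t * k) G univ p (by rw [card_univ]) le_rfl hG (by rwa [card_univ]) hp
    exact hno hf.isContained

end UpperBound

/-! ### The lower bound: the extremal colouring. -/

section LowerBound

/-- The colour class of a vertex in the extremal colouring. -/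
def part (n : ℕ) (i : ℕ) : ℕ := if i < n - 1 then 0 else if i < 2 * (n - 1) then 1 else 2

/-- The red graph of the extremal colouring: three cliques, two of them on `n - 1` vertices. -/
def extremal (n M : ℕ) : SimpleGraph (Fin M) where
  Adj x y := x ≠ y ∧ part n x = part n y
  symm := ⟨fun _ _ h => ⟨h.1.symm, h.2.symm⟩⟩
  loopless := ⟨fun _ h => h.1 rfl⟩

/-- Connectivity traps a red `G` in one clique of fewer than `n` vertices. A page together with the
spine is a blue triangle meeting all three parts, so disjoint books use distinct vertices of the
third part, which has at most `t - 1`. -/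
theorem not_arrows {V : Type*} [Fintype V] {G : SimpleGraph V} {k t n M : ℕ} (hk : 1 ≤ k)
    (ht : 1 ≤ t) (htn : t ≤ n) (hV : Fintype.card V = n) (hG : G.Connected)
    (hM : M + 2 < 2 * n + t) : ¬ Arrows M G (copies t (book k)) := by
  intro h
  rcases h (extremal n M) with ⟨f, hf⟩ | hb
  · have hpart : ∀ u v, part n (f u) = part n (f v) := by
      intro u v
      obtain ⟨w⟩ := hG.preconnected u v
      induction w with
      | nil => rfl
      | cons h _ ih => exact ((f.map_adj h).2).trans ih
    obtain ⟨v0⟩ := hG.nonempty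
    have hinj : Function.Injective fun v => ((f v : Fin M) : ℕ) := Fin.val_injective.comp hf
    have hcard : #(univ.image fun v => ((f v : Fin M) : ℕ)) = n := by
      rw [card_image_of_injective _ hinj, card_univ, hV]
    have hbound : ∀ a, #((range M).filter fun i => part n i = a) ≤ n - 1 := by
      intro a
      -- The third part also fits in an interval of length `n - 1`, because `t ≤ n`.
      have hs : ((range M).filter fun i => part n i = a) ⊆
          Ico (a * (n - 1)) (a * (n - 1) + (n - 1)) := by
        intro i hi
        rw [mem_filter, mem_range] at hi
        obtain ⟨hiM, rfl⟩ := hi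
        rw [mem_Ico]
        unfold part
        split_ifs <;> omega
      simpa using card_le_card hs
    have hsub : (univ.image fun v => ((f v : Fin M) : ℕ)) ⊆
        (range M).filter fun i => part n i = part n (f v0) := by
      intro i hi
      obtain ⟨v, -, rfl⟩ := mem_image.1 hi
      exact mem_filter.2 ⟨mem_range.2 (f v).2, hpart v v0⟩
    have h1 := card_le_card hsub
    have h2 := hbound (part n (f v0))
    omega
  · obtain ⟨F, hinj, hadj⟩ := copies_isContained_iff.1 hb
    have hblue : ∀ i a b, (book k).Adj a b → part n (F i a) ≠ part n (F i b) := by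
      intro i a b hab e
      have := hadj i a b hab
      rw [SimpleGraph.compl_adj] at this
      exact this.2 ⟨this.1, e⟩
    have hthird : ∀ i, ∃ a, 2 * (n - 1) ≤ (F i a : ℕ) := by
      intro i
      by_contra! hlt
      have h1 := hblue i (Sum.inl 0) (Sum.inl 1) (by simp [book, join])
      have h2 := hblue i (Sum.inl 0) (Sum.inr ⟨0, hk⟩) (by simp [book, join])
      have h3 := hblue i (Sum.inl 1) (Sum.inr ⟨0, hk⟩) (by simp [book, join])
      have key : ∀ a, part n (F i a) ≤ 1 := fun a => by
        have := hlt a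
        unfold part
        split_ifs <;> omega
      have := key (Sum.inl 0)
      have := key (Sum.inl 1)
      have := key (Sum.inr ⟨0, hk⟩)
      omega
    choose a ha using hthird
    have hi : Function.Injective fun i => ((F i (a i) : Fin M) : ℕ) := fun i j e =>
      (hinj i _ j _ (Fin.val_injective e)).1
    have hc := card_image_of_injective univ hi
    have hs : (univ.image fun i => ((F i (a i) : Fin M) : ℕ)) ⊆ Ico (2 * (n - 1)) M := by
      intro x hx
      obtain ⟨i, -, rfl⟩ := mem_image.1 hx
      exact mem_Ico.2 ⟨ha i, (F i (a i)).2⟩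
    have := card_le_card hs
    rw [hc, card_univ, Fintype.card_fin, Nat.card_Ico] at this
    omega

end LowerBound
end BookRamsey

/-! ### The Ramsey number. -/

theorem theorem1p8 {V : Type*} [Fintype V] (k t n : ℕ) (hk : 1 ≤ k) (ht : 1 ≤ t)
    (hn : 111 * t ^ 3 * k ^ 3 ≤ n)
    (G : SimpleGraph V) (hV : Fintype.card V = n) (hG : G.Connected)
    (hE : (G.edgeSet.ncard : ℝ) ≤
      (n : ℝ) * (1 + 1 / (127 * (t : ℝ) ^ 2 * (k : ℝ) ^ 2 + 79 * (t : ℝ) ^ 2 * (k : ℝ)))) :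
    BookRamsey.IsRamseyNumber G (BookRamsey.copies t (BookRamsey.book k)) (2 * n + t - 2) := by
  have htP : t ≤ t * k := Nat.le_mul_of_pos_right _ (by omega)
  have hPP : t * k ≤ t * k * (t * k) := Nat.le_mul_of_pos_left _ (by omega)
  have hPPP : t * k * (t * k) ≤ t * k * (t * k) * (t * k) := Nat.le_mul_of_pos_right _ (by omega)
  have hn' : 111 * (t * k * (t * k) * (t * k)) ≤ n := by
    rwa [show 111 * (t * k * (t * k) * (t * k)) = 111 * t ^ 3 * k ^ 3 by ring]
  refine ⟨⟨by omega, fun R => ?_⟩, fun M hM => ?_⟩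
  -- The excess is `l = e(G) - n` in truncated subtraction, so it is 0 for a tree. Clearing the
  -- denominator of the edge bound gives the inequality.
  · have hl : (G.edgeSet.ncard - n) * (127 * (t * k * (t * k)) + 79 * (t * (t * k))) ≤ n := by
      rcases le_total G.edgeSet.ncard n with h | h
      · simp [Nat.sub_eq_zero_of_le h]
      have hpos : (0 : ℝ) < 127 * (t : ℝ) ^ 2 * (k : ℝ) ^ 2 + 79 * (t : ℝ) ^ 2 * (k : ℝ) := by
        have : (0 : ℝ) < t := by exact_mod_cast ht
        have : (0 : ℝ) < k := by exact_mod_cast hk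
        positivity
      have h1 : ((G.edgeSet.ncard : ℝ) - n) *
          (127 * (t : ℝ) ^ 2 * (k : ℝ) ^ 2 + 79 * (t : ℝ) ^ 2 * (k : ℝ)) ≤ n := by
        rw [← le_div_iff₀ hpos]
        have : (n : ℝ) * (1 + 1 / (127 * (t : ℝ) ^ 2 * (k : ℝ) ^ 2 + 79 * (t : ℝ) ^ 2 * (k : ℝ))) =
            n + n / (127 * (t : ℝ) ^ 2 * (k : ℝ) ^ 2 + 79 * (t : ℝ) ^ 2 * (k : ℝ)) := by ring
        linarith
      rw [← Nat.cast_sub h] at h1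
      have h2 : (((G.edgeSet.ncard - n) * (127 * (t * k * (t * k)) + 79 * (t * (t * k))) : ℕ) : ℝ) ≤
          (n : ℝ) := by
        refine le_trans (le_of_eq ?_) h1
        push_cast
        ring
      exact_mod_cast h2
    refine BookRamsey.isContained_or_copies_book ht hk ?_ (BookRamsey.connOn_univ hG)
      (l := G.edgeSet.ncard - n) ?_ (by rwa [hV]) (by rwa [hV])
    · rw [Fintype.card_fin, hV]; omega
    · rw [BookRamsey.degSum_univ, hV]; omega
  · by_contra hlt
    exact BookRamsey.not_arrows hk ht (by omega) hV hG (by omega) hM.2
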